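/- Let $\mathcal C$ be a hermitian category, i.e. an additive category with a contravariant functor $*:\mathcal C\to\mathcal C$ and a natural transformation $\omega:\mathrm{id}\to{**}$ such that $\omega_X^*\,\omega_{X^*}=\mathrm{id}_{X^*}$ for every object $X$ (the morphisms $\omega_X$ need not be isomorphisms; $X$ is called reflexive if $\omega_X$ is an isomorphism). A sesquilinear form over $\mathcal C$ is a pair $(M,s)$ with $M\in\mathcal C$ and $s\in\mathrm{Hom}(M,M^*)$. An isometry $(M,s)\to(M',s')$ is an isomorphism $f:M\to M'$ with $s=f^*s'f$. The form $(M,s)$ is unimodular if $s$ and $s^*\omega_M$ are isomorphisms, and hermitian if $s=s^*\omega_M$. A unimodular hermitian form is hyperbolic if it is isometric to $$\Bigl(Q\oplus Q^*,\ \begin{pmatrix}0&\mathrm{id}_{Q^*}\\ \omega_Q&0\end{pmatrix}\Bigr)$$ for some reflexive object $Q$. The Witt group $W(\mathcal C)$ is the Grothendieck group of isometry classes of unimodular hermitian forms over $\mathcal C$ (with respect to orthogonal sum) modulo the subgroup generated by the hyperbolic forms. The category $\mathrm{Ar}_2(\mathcal C)$ of twisted double arrows has as objects the quadruples $(M,N,f,g)$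 with $f,g\in\mathrm{Hom}(M,N^*)$; a morphism $(M,N,f,g)\to(M',N',f',g')$ is a pair $(\phi,\psi)$ with $\phi\in\mathrm{Hom}(M,M')$, $\psi\in\mathrm{Hom}(N',N)$, $f'\phi=\psi^*f$ and $g'\phi=\psi^*g$. It is a hermitian category with $(M,N,f,g)^*=(N,M,g^*\omega_N,f^*\omega_N)$, $(\phi,\psi)^*=(\psi,\phi)$ and $\omega_{(M,N,f,g)}=(\mathrm{id}_M,\mathrm{id}_N)$. To a sesquilinear form $(M,s)$ over $\mathcal C$ one associates the unimodular hermitian form $F(M,s)=\bigl((M,M,s^*\omega_M,s),(\mathrm{id}_M,\mathrm{id}_M)\bigr)$ over $\mathrm{Ar}_2(\mathcal C)$, and $(M,s)$ is called hyperbolic if $F(M,s)$ is hyperbolic as a unimodular hermitian form. The Witt group of sesquilinear forms $W_S(\mathcal C)$ is the Grothendieck group of isometry classes of all sesquilinear forms over $\mathcal C$ (with respect to orthogonal sum) modulo the subgroup generated by the hyperbolic sesquilinear forms. Sending the class of a unimodular hermitian form to its class as a sesquilinear form defines a group homomorphism $W(\mathcal C)\to W_S(\mathcal C)$. **Theorem.**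 Let $\mathcal C$ be a hermitian category in which all idempotents split, and assume that one of the following holds: 1. there is a commutative noetherian complete semilocal ring $K$ with $2\in K^\times$ (complete semilocal: $K/\mathrm{Jac}(K)$ is semisimple and $K$ is complete and separated in the $\mathrm{Jac}(K)$-adic topology) such that $\mathcal C$ is a $K$-category, $*$ is $K$-linear on morphisms, and $\mathrm{Hom}(M,N)$ is a finitely generated $K$-module for all $M,N\in\mathcal C$; or 2. for every $M\in\mathcal C$ the ring $\mathrm{End}(M)$ is semiprimary (its Jacobson radical is nilpotent and the quotient by it is semisimple) and $2\in\mathrm{End}(M)^\times$. Then a sesquilinear form $(M,s)$ over $\mathcal C$ has trivial class in $W_S(\mathcal C)$ if and only if it is hyperbolic. Moreover, the homomorphism $W(\mathcal C)\to W_S(\mathcal C)$ is injective. -/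

import Mathlib

open CategoryTheory CategoryTheory.Limits Opposite
open scoped ZeroObject

universe w v u

set_option linter.unusedSectionVars false

namespace HermCat

/-- A hermitian structure `(*, ω)` on a category: a contravariant functor `*` and a natural
transformation `ω : id ⟶ **` with `ω_X^* ∘ ω_{X^*} = id`. The transformation `ω` need not be
an isomorphism, that is, objects need not be reflexive. On an additive category the functor `*` is
automatically additive, see `HermCat.star_additive`. -/
class HermitianStructure (C : Type u) [Category.{v} C] where
  star : Cᵒᵖ ⥤ C
  omega : 𝟭 C ⟶ star.rightOp ⋙ star
  omega_triangle : ∀ X : C,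
    omega.app (star.obj (op X)) ≫ star.map (omega.app X).op = 𝟙 (star.obj (op X))

section Basic

variable {C : Type u} [Category.{v} C] [HermitianStructure C]

/-- The dual object `X^*`. -/
def dual (X : C) : C := HermitianStructure.star.obj (op X)

/-- The dual morphism `f^* : Y^* ⟶ X^*` of `f : X ⟶ Y`. -/
def dualMap {X Y : C} (f : X ⟶ Y) : dual Y ⟶ dual X := HermitianStructure.star.map f.op

/-- The canonical morphism `ω_X : X ⟶ X^{**}`. -/
def bidual (X : C) : X ⟶ dual (dual X) := HermitianStructure.omega.app X

@[simp] theorem dualMap_id (X : C) : dualMap (𝟙 X) = 𝟙 (dual X) := by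
  simp [dualMap, dual]

@[simp] theorem dualMap_comp {X Y Z : C} (f : X ⟶ Y) (g : Y ⟶ Z) :
    dualMap (f ≫ g) = dualMap g ≫ dualMap f :=
  HermitianStructure.star.map_comp g.op f.op

theorem dualMap_comp_assoc {X Y Z W : C} (f : X ⟶ Y) (g : Y ⟶ Z) (h : dual X ⟶ W) :
    dualMap (f ≫ g) ≫ h = dualMap g ≫ dualMap f ≫ h := by
  rw [dualMap_comp, Category.assoc]

theorem bidual_naturality {X Y : C} (f : X ⟶ Y) :
    f ≫ bidual Y = bidual X ≫ dualMap (dualMap f) :=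
  (HermitianStructure.omega (C := C)).naturality f

@[simp] theorem bidual_dual (X : C) : bidual (dual X) ≫ dualMap (bidual X) = 𝟙 (dual X) :=
  HermitianStructure.omega_triangle X

/-- Transposing twice is the identity: for `f : X ⟶ Y^*` one has `(f^* ω_Y)^* ω_X = f`. -/
@[simp] theorem transpose_transpose {X Y : C} (f : X ⟶ dual Y) :
    bidual X ≫ dualMap (bidual Y ≫ dualMap f) = f := by
  rw [dualMap_comp, ← Category.assoc, ← bidual_naturality, Category.assoc, bidual_dual,
    Category.comp_id]

theorem transpose_conj {X Y : C} (e : X ⟶ Y) (s : Y ⟶ dual Y) :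
    bidual X ≫ dualMap (e ≫ s ≫ dualMap e) = e ≫ (bidual Y ≫ dualMap s) ≫ dualMap e := by
  rw [dualMap_comp, dualMap_comp, ← Category.assoc, ← Category.assoc, ← Category.assoc,
    ← bidual_naturality]
  simp only [Category.assoc]

theorem id_comm {X Y : C} {f f' : X ⟶ dual Y} (h : f' = f) : 𝟙 X ≫ f' = f ≫ dualMap (𝟙 Y) := by
  simp [h]

/-- An object `X` is reflexive if `ω_X` is an isomorphism. -/
def IsReflexive (X : C) : Prop := IsIso (bidual X)

variable (C) in
/-- The functor `*` is self-adjoint (on the right). -/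
def starAdj : (HermitianStructure.star (C := C)).rightOp ⊣ HermitianStructure.star (C := C) where
  unit := HermitianStructure.omega
  counit :=
    { app := fun X => (HermitianStructure.omega.app X.unop).op
      naturality := fun _ _ f =>
        Quiver.Hom.unop_inj (HermitianStructure.omega.naturality f.unop).symm }
  left_triangle_components X :=
    Quiver.Hom.unop_inj (HermitianStructure.omega_triangle X)
  right_triangle_components X := HermitianStructure.omega_triangle X.unop

end Basic

section Additive

variable {C : Type u} [Category.{v} C] [Preadditive C] [HasZeroObject C]
  [HasBinaryBiproducts C] [HermitianStructure C]

theorem star_additive : (HermitianStructure.star (C := C)).Additive := by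
  have : PreservesLimitsOfSize.{0, 0} (HermitianStructure.star (C := C)) :=
    (starAdj C).rightAdjoint_preservesLimits
  exact Functor.additive_of_preserves_binary_products _

@[simp] theorem dualMap_add {X Y : C} (f g : X ⟶ Y) :
    dualMap (f + g) = dualMap f + dualMap g := by
  have := star_additive (C := C)
  exact (HermitianStructure.star (C := C)).map_add (f := f.op) (g := g.op)

@[simp] theorem dualMap_zero (X Y : C) : dualMap (0 : X ⟶ Y) = 0 := by
  have := star_additive (C := C)
  exact (HermitianStructure.star (C := C)).map_zero (op Y) (op X)

@[simp] theorem dualMap_neg {X Y : C} (f : X ⟶ Y) : dualMap (-f) = -dualMap f := by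
  have := star_additive (C := C)
  exact (HermitianStructure.star (C := C)).map_neg (f := f.op)

/-- The diagonal matrix with entries `f`, `g`, under the identification of `(X ⊕ Y)^*` with
`X^* ⊕ Y^*`. -/
noncomputable def diagMat {X Y : C} (f : X ⟶ dual X) (g : Y ⟶ dual Y) : X ⊞ Y ⟶ dual (X ⊞ Y) :=
  biprod.fst ≫ f ≫ dualMap biprod.fst + biprod.snd ≫ g ≫ dualMap biprod.snd

/-- The off-diagonal matrix with rows `(0, p)` and `(q, 0)`, under the identification of
`(M ⊕ N)^*` with `M^* ⊕ N^*`. -/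
noncomputable def offDiagMat {M N : C} (p : N ⟶ dual M) (q : M ⟶ dual N) : M ⊞ N ⟶ dual (M ⊞ N) :=
  biprod.snd ≫ p ≫ dualMap biprod.fst + biprod.fst ≫ q ≫ dualMap biprod.snd

theorem transpose_diagMat {X Y : C} (f : X ⟶ dual X) (g : Y ⟶ dual Y) :
    bidual (X ⊞ Y) ≫ dualMap (diagMat f g)
      = diagMat (bidual X ≫ dualMap f) (bidual Y ≫ dualMap g) := by
  rw [diagMat, dualMap_add, Preadditive.comp_add, transpose_conj, transpose_conj, diagMat]

theorem isIso_diagMat {X Y : C} (f : X ⟶ dual X) (g : Y ⟶ dual Y) [IsIso f] [IsIso g] :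
    IsIso (diagMat f g) := by
  refine ⟨dualMap biprod.inl ≫ inv f ≫ biprod.inl + dualMap biprod.inr ≫ inv g ≫ biprod.inr,
    ?_, ?_⟩
  · simp [diagMat, ← dualMap_comp_assoc]
  · simp [diagMat, ← dualMap_comp, ← dualMap_add]

theorem transpose_offDiagMat {M N : C} (p : N ⟶ dual M) (q : M ⟶ dual N) :
    bidual (M ⊞ N) ≫ dualMap (offDiagMat p q)
      = offDiagMat (bidual N ≫ dualMap q) (bidual M ≫ dualMap p) := by
  have h1 := bidual_naturality (biprod.fst : M ⊞ N ⟶ M)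
  have h2 := bidual_naturality (biprod.snd : M ⊞ N ⟶ N)
  simp only [offDiagMat, dualMap_add, dualMap_comp, Preadditive.comp_add, Category.assoc]
  rw [← Category.assoc (bidual _) (dualMap (dualMap _)), ← h1,
    ← Category.assoc (bidual _) (dualMap (dualMap _)), ← h2, add_comm]
  simp only [Category.assoc]

theorem offDiagMat_inl {M N : C} (p : N ⟶ dual M) (q : M ⟶ dual N) :
    offDiagMat p q ≫ dualMap biprod.inl = biprod.snd ≫ p := by
  simp [offDiagMat, ← dualMap_comp]

theorem offDiagMat_inr {M N : C} (p : N ⟶ dual M) (q : M ⟶ dual N) :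
    offDiagMat p q ≫ dualMap biprod.inr = biprod.fst ≫ q := by
  simp [offDiagMat, ← dualMap_comp]

theorem inl_offDiagMat {M N : C} (p : N ⟶ dual M) (q : M ⟶ dual N) :
    biprod.inl ≫ offDiagMat p q = q ≫ dualMap biprod.snd := by
  simp [offDiagMat]

theorem inr_offDiagMat {M N : C} (p : N ⟶ dual M) (q : M ⟶ dual N) :
    biprod.inr ≫ offDiagMat p q = p ≫ dualMap biprod.fst := by
  simp [offDiagMat]

theorem lift_offDiagMat {X Q : C} (a : X ⟶ Q) (b : X ⟶ dual Q) :
    biprod.lift a b ≫ offDiagMat (𝟙 (dual Q)) (bidual Q) ≫ dualMap (biprod.lift a b)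
      = b ≫ dualMap a + a ≫ bidual Q ≫ dualMap b := by
  simp [offDiagMat, ← dualMap_comp]

theorem lift_desc_eq {X Q R : C} (a : X ⟶ Q) (b : X ⟶ R) (a' : Q ⟶ X) (b' : R ⟶ X)
    (haa : a' ≫ a = 𝟙 Q) (hab : a' ≫ b = 0) (hba : b' ≫ a = 0) (hbb : b' ≫ b = 𝟙 R) :
    biprod.desc a' b' ≫ biprod.lift a b = 𝟙 _ := by
  ext <;> simp [haa, hab, hba, hbb]

end Additive

/-! ### Sesquilinear forms -/

/-- A sesquilinear form `(M, s)` over a hermitian category: an object `M` and an arbitrary morphism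
`s : M ⟶ M^*`. -/
structure SesqForm (C : Type u) [Category.{v} C] [HermitianStructure C] where
  obj : C
  form : obj ⟶ dual obj

namespace SesqForm

section

variable {C : Type u} [Category.{v} C] [HermitianStructure C]

/-- `s` is unimodular if `s` and `s^* ω` are isomorphisms. -/
def IsUnimodular (s : SesqForm C) : Prop :=
  IsIso s.form ∧ IsIso (bidual s.obj ≫ dualMap s.form)

/-- `s` is (1-)hermitian if `s = s^* ω`. -/
def IsHermitian (s : SesqForm C) : Prop := s.form = bidual s.obj ≫ dualMap s.form

/-- `(M, s)` and `(M', s')` are isometric if there is an isomorphism `f : M ≅ M'` such that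
`s = f^* s' f`. -/
def Isometric (s t : SesqForm C) : Prop :=
  ∃ e : s.obj ≅ t.obj, s.form = e.hom ≫ t.form ≫ dualMap e.hom

theorem Isometric.refl (s : SesqForm C) : Isometric s s := ⟨Iso.refl _, by simp⟩

theorem Isometric.trans {s t r : SesqForm C} :
    Isometric s t → Isometric t r → Isometric s r := by
  rintro ⟨e, he⟩ ⟨e', he'⟩
  exact ⟨e ≪≫ e', by simp [he, he']⟩

theorem Isometric.symm {s t : SesqForm C} : Isometric s t → Isometric t s := by
  rintro ⟨e, he⟩
  refine ⟨e.symm, ?_⟩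
  simp [he, ← dualMap_comp]

theorem Isometric.isHermitian {s t : SesqForm C} (h : Isometric s t) (hs : s.IsHermitian) :
    t.IsHermitian := by
  obtain ⟨e, he⟩ := h.symm
  unfold IsHermitian at *
  rw [he, transpose_conj, ← hs]

theorem Isometric.isUnimodular {s t : SesqForm C} (h : Isometric s t) (hs : s.IsUnimodular) :
    t.IsUnimodular := by
  obtain ⟨e, he⟩ := h.symm
  obtain ⟨h1, h2⟩ := hs
  have hd : IsIso (dualMap e.hom) :=
    ⟨dualMap e.inv, by simp [← dualMap_comp], by simp [← dualMap_comp]⟩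
  refine ⟨by rw [he]; infer_instance, ?_⟩
  have : bidual t.obj ≫ dualMap t.form
      = e.hom ≫ (bidual s.obj ≫ dualMap s.form) ≫ dualMap e.hom := by
    rw [he, transpose_conj]
  rw [this]
  infer_instance

end

section

variable {C : Type u} [Category.{v} C] [Preadditive C] [HasZeroObject C]
  [HasBinaryBiproducts C] [HermitianStructure C]

/-- The orthogonal sum of two sesquilinear forms. Under the identification of `(M ⊕ M')^*` with
`M^* ⊕ M'^*` it is the diagonal matrix with entries `s` and `s'`. -/
noncomputable def orthoSum (s t : SesqForm C) : SesqForm C where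
  obj := s.obj ⊞ t.obj
  form := diagMat s.form t.form

variable (C) in
/-- The form on the zero object. -/
noncomputable def zeroForm : SesqForm C where
  obj := 0
  form := 0

/-- The hyperbolic form `H_Q` on `Q ⊕ Q^*`. Under the identification of `(Q ⊕ Q^*)^*` with
`Q^* ⊕ Q^{**}` it is the matrix with rows `(0, id)` and `(ω_Q, 0)`. -/
noncomputable def hyp (Q : C) : SesqForm C where
  obj := Q ⊞ dual Q
  form := offDiagMat (𝟙 (dual Q)) (bidual Q)

/-- Hyperbolicity for unimodular hermitian forms: being isometric to `H_Q` for some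
reflexive object `Q`. -/
def IsHermHyperbolic (s : SesqForm C) : Prop :=
  ∃ Q : C, IsReflexive Q ∧ Isometric s (hyp Q)

end

end SesqForm

/-! ### The category of twisted double arrows -/

/-- Objects of the category of twisted double arrows: quadruples `(M, N, f, g)` with
`f, g : M ⟶ N^*`. -/
structure TwistedArrow (C : Type u) [Category.{v} C] [HermitianStructure C] where
  src : C
  tgt : C
  f : src ⟶ dual tgt
  g : src ⟶ dual tgt

namespace TwistedArrow

section

variable {C : Type u} [Category.{v} C] [HermitianStructure C]

/-- Morphisms `(M, N, f, g) ⟶ (M', N', f', g')`: pairs `φ : M ⟶ M'`, `ψ : N' ⟶ N` with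
`f' φ = ψ^* f` and `g' φ = ψ^* g`. -/
@[ext]
structure Hom (Z W : TwistedArrow C) where
  φ : Z.src ⟶ W.src
  ψ : W.tgt ⟶ Z.tgt
  comm_f : φ ≫ W.f = Z.f ≫ dualMap ψ
  comm_g : φ ≫ W.g = Z.g ≫ dualMap ψ

instance : Category (TwistedArrow C) where
  Hom := Hom
  id Z := ⟨𝟙 _, 𝟙 _, by simp, by simp⟩
  comp a b := ⟨a.φ ≫ b.φ, b.ψ ≫ a.ψ,
    by rw [Category.assoc, b.comm_f, ← Category.assoc, a.comm_f, Category.assoc, dualMap_comp],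
    by rw [Category.assoc, b.comm_g, ← Category.assoc, a.comm_g, Category.assoc, dualMap_comp]⟩
  id_comp a := Hom.ext (Category.id_comp _) (Category.comp_id _)
  comp_id a := Hom.ext (Category.comp_id _) (Category.id_comp _)
  assoc a b c := Hom.ext (Category.assoc _ _ _) (Category.assoc _ _ _).symm

@[ext]
theorem hom_ext {Z W : TwistedArrow C} {a b : Z ⟶ W} (h1 : a.φ = b.φ) (h2 : a.ψ = b.ψ) : a = b :=
  Hom.ext h1 h2

@[simp] theorem id_φ (Z : TwistedArrow C) : (𝟙 Z : Z ⟶ Z).φ = 𝟙 Z.src := rfl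
@[simp] theorem id_ψ (Z : TwistedArrow C) : (𝟙 Z : Z ⟶ Z).ψ = 𝟙 Z.tgt := rfl
@[simp] theorem comp_φ {X Y Z : TwistedArrow C} (a : X ⟶ Y) (b : Y ⟶ Z) :
    (a ≫ b).φ = a.φ ≫ b.φ := rfl
@[simp] theorem comp_ψ {X Y Z : TwistedArrow C} (a : X ⟶ Y) (b : Y ⟶ Z) :
    (a ≫ b).ψ = b.ψ ≫ a.ψ := rfl

/-- The dual `(M, N, f, g)^* = (N, M, g^* ω_N, f^* ω_N)`. -/
def dualObj (Z : TwistedArrow C) : TwistedArrow C where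
  src := Z.tgt
  tgt := Z.src
  f := bidual Z.tgt ≫ dualMap Z.g
  g := bidual Z.tgt ≫ dualMap Z.f

theorem dual_comm {Z W : TwistedArrow C} (φ : Z.src ⟶ W.src) (ψ : W.tgt ⟶ Z.tgt)
    (f : Z.src ⟶ dual Z.tgt) (f' : W.src ⟶ dual W.tgt) (h : φ ≫ f' = f ≫ dualMap ψ) :
    ψ ≫ bidual Z.tgt ≫ dualMap f = (bidual W.tgt ≫ dualMap f') ≫ dualMap φ := by
  rw [← Category.assoc, bidual_naturality, Category.assoc, ← dualMap_comp, ← h, dualMap_comp,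
    Category.assoc]

/-- The dual `(φ, ψ)^* = (ψ, φ)` of a morphism. -/
def dualHom {Z W : TwistedArrow C} (a : Z ⟶ W) : dualObj W ⟶ dualObj Z where
  φ := a.ψ
  ψ := a.φ
  comm_f := dual_comm a.φ a.ψ Z.g W.g a.comm_g
  comm_g := dual_comm a.φ a.ψ Z.f W.f a.comm_f

/-- The hermitian structure on twisted double arrows: `*` is given by `dualObj` and `dualHom`, and
`ω_Z = (id, id)`. -/
instance : HermitianStructure (TwistedArrow C) where
  star :=
    { obj := fun Z => dualObj Z.unop
      map := fun a => dualHom a.unop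
      map_id := fun _ => rfl
      map_comp := fun _ _ => rfl }
  omega :=
    { app := fun Z =>
        ⟨𝟙 Z.src, 𝟙 Z.tgt, id_comm (transpose_transpose Z.f), id_comm (transpose_transpose Z.g)⟩
      naturality := fun Z W a => by
        apply Hom.ext
        · exact (Category.comp_id a.φ).trans (Category.id_comp a.φ).symm
        · exact (Category.id_comp a.ψ).trans (Category.comp_id a.ψ).symm }
  omega_triangle := fun Z => Hom.ext (Category.id_comp _) (Category.id_comp _)

@[simp] theorem dualMap_φ {Z W : TwistedArrow C} (a : Z ⟶ W) : (dualMap a).φ = a.ψ := rfl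
@[simp] theorem dualMap_ψ {Z W : TwistedArrow C} (a : Z ⟶ W) : (dualMap a).ψ = a.φ := rfl
@[simp] theorem bidual_φ (Z : TwistedArrow C) : (bidual Z).φ = 𝟙 Z.src := rfl
@[simp] theorem bidual_ψ (Z : TwistedArrow C) : (bidual Z).ψ = 𝟙 Z.tgt := rfl

theorem isReflexive (Z : TwistedArrow C) : IsReflexive Z :=
  ⟨⟨𝟙 Z.src, 𝟙 Z.tgt, id_comm (transpose_transpose Z.f).symm,
      id_comm (transpose_transpose Z.g).symm⟩,
    Hom.ext (Category.id_comp _) (Category.id_comp _),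
    Hom.ext (Category.id_comp _) (Category.id_comp _)⟩

end

section

variable {C : Type u} [Category.{v} C] [Preadditive C] [HasZeroObject C]
  [HasBinaryBiproducts C] [HermitianStructure C]

instance (Z W : TwistedArrow C) : Zero (Z ⟶ W) := ⟨⟨0, 0, by simp, by simp⟩⟩

instance (Z W : TwistedArrow C) : Add (Z ⟶ W) :=
  ⟨fun a b => ⟨a.φ + b.φ, a.ψ + b.ψ, by simp [a.comm_f, b.comm_f], by simp [a.comm_g, b.comm_g]⟩⟩

instance (Z W : TwistedArrow C) : Neg (Z ⟶ W) :=
  ⟨fun a => ⟨-a.φ, -a.ψ, by simp [a.comm_f], by simp [a.comm_g]⟩⟩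

@[simp] theorem zero_φ (Z W : TwistedArrow C) : (0 : Z ⟶ W).φ = 0 := rfl
@[simp] theorem zero_ψ (Z W : TwistedArrow C) : (0 : Z ⟶ W).ψ = 0 := rfl
@[simp] theorem add_φ {Z W : TwistedArrow C} (a b : Z ⟶ W) : (a + b).φ = a.φ + b.φ := rfl
@[simp] theorem add_ψ {Z W : TwistedArrow C} (a b : Z ⟶ W) : (a + b).ψ = a.ψ + b.ψ := rfl
@[simp] theorem neg_φ {Z W : TwistedArrow C} (a : Z ⟶ W) : (-a).φ = -a.φ := rfl
@[simp] theorem neg_ψ {Z W : TwistedArrow C} (a : Z ⟶ W) : (-a).ψ = -a.ψ := rfl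

/-- Morphisms of twisted double arrows are added componentwise. -/
instance : Preadditive (TwistedArrow C) where
  homGroup Z W :=
    { add_assoc := fun _ _ _ => by ext <;> simp [add_assoc]
      zero_add := fun _ => by ext <;> simp
      add_zero := fun _ => by ext <;> simp
      neg_add_cancel := fun _ => by ext <;> simp
      add_comm := fun _ _ => by ext <;> simp [add_comm]
      nsmul := nsmulRec
      zsmul := zsmulRec }
  add_comp _ _ _ _ _ _ := by ext <;> simp
  comp_add _ _ _ _ _ _ := by ext <;> simp

instance : HasZeroObject (TwistedArrow C) := by
  refine ⟨⟨⟨0, 0, 0, 0⟩, ?_⟩⟩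
  rw [IsZero.iff_id_eq_zero]
  exact Hom.ext ((isZero_zero C).eq_of_src _ _) ((isZero_zero C).eq_of_src _ _)

/-- The componentwise biproduct of twisted double arrows. -/
noncomputable def biprodObj (Z W : TwistedArrow C) : TwistedArrow C where
  src := Z.src ⊞ W.src
  tgt := Z.tgt ⊞ W.tgt
  f := biprod.fst ≫ Z.f ≫ dualMap biprod.fst + biprod.snd ≫ W.f ≫ dualMap biprod.snd
  g := biprod.fst ≫ Z.g ≫ dualMap biprod.fst + biprod.snd ≫ W.g ≫ dualMap biprod.snd

/-- The biproduct diagram of two twisted double arrows. -/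
noncomputable def biprodBicone (Z W : TwistedArrow C) : BinaryBicone Z W where
  pt := biprodObj Z W
  fst := Hom.mk (W := Z) (Z := biprodObj Z W) biprod.fst biprod.inl
    (by simp [biprodObj, ← dualMap_comp]) (by simp [biprodObj, ← dualMap_comp])
  snd := Hom.mk (W := W) (Z := biprodObj Z W) biprod.snd biprod.inr
    (by simp [biprodObj, ← dualMap_comp]) (by simp [biprodObj, ← dualMap_comp])
  inl := Hom.mk (Z := Z) (W := biprodObj Z W) biprod.inl biprod.fst
    (by simp [biprodObj]) (by simp [biprodObj])
  inr := Hom.mk (Z := W) (W := biprodObj Z W) biprod.inr biprod.snd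
    (by simp [biprodObj]) (by simp [biprodObj])
  inl_fst := Hom.ext biprod.inl_fst biprod.inl_fst
  inl_snd := Hom.ext biprod.inl_snd biprod.inr_fst
  inr_fst := Hom.ext biprod.inr_fst biprod.inl_snd
  inr_snd := Hom.ext biprod.inr_snd biprod.inr_snd

theorem hasBinaryBiproduct (Z W : TwistedArrow C) : HasBinaryBiproduct Z W :=
  HasBinaryBiproduct.mk
    { bicone := biprodBicone Z W
      isBilimit := isBinaryBilimitOfTotal _ (Hom.ext biprod.total biprod.total) }

instance : HasBinaryBiproducts (TwistedArrow C) := ⟨hasBinaryBiproduct⟩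

end

end TwistedArrow

namespace SesqForm

section

variable {C : Type u} [Category.{v} C] [HermitianStructure C]

/-- The functor `F` from sesquilinear forms over `C` to unimodular hermitian forms over twisted
double arrows in `C`, on objects: `F(M, s) = ((M, M, s^* ω_M, s), (id_M, id_M))`. -/
def toTwisted (s : SesqForm C) : SesqForm (TwistedArrow C) where
  obj := ⟨s.obj, s.obj, bidual s.obj ≫ dualMap s.form, s.form⟩
  form := ⟨𝟙 s.obj, 𝟙 s.obj, id_comm rfl, id_comm (transpose_transpose s.form)⟩

theorem toTwisted_isHermitian (s : SesqForm C) : s.toTwisted.IsHermitian :=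
  TwistedArrow.Hom.ext (Category.id_comp _).symm (Category.id_comp _).symm

theorem toTwisted_isUnimodular (s : SesqForm C) : s.toTwisted.IsUnimodular := by
  have h : IsIso s.toTwisted.form :=
    ⟨⟨𝟙 s.obj, 𝟙 s.obj, id_comm rfl, id_comm (transpose_transpose s.form).symm⟩,
      TwistedArrow.Hom.ext (Category.id_comp _) (Category.id_comp _),
      TwistedArrow.Hom.ext (Category.id_comp _) (Category.id_comp _)⟩
  exact ⟨h, by rw [← toTwisted_isHermitian s]; exact h⟩

/-- `F` sends an isometry `ψ` to the isometry `(ψ, ψ⁻¹)`. -/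
theorem Isometric.toTwisted {s t : SesqForm C} (h : Isometric s t) :
    Isometric s.toTwisted t.toTwisted := by
  obtain ⟨e, he⟩ := h
  have he' : bidual s.obj ≫ dualMap s.form
      = e.hom ≫ (bidual t.obj ≫ dualMap t.form) ≫ dualMap e.hom := by
    rw [he, transpose_conj]
  refine ⟨⟨⟨e.hom, e.inv, ?_, ?_⟩, ⟨e.inv, e.hom, ?_, ?_⟩, ?_, ?_⟩, ?_⟩
  · simp [SesqForm.toTwisted, he', ← dualMap_comp]
  · simp [SesqForm.toTwisted, he, ← dualMap_comp]
  · simp [SesqForm.toTwisted, he']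
  · simp [SesqForm.toTwisted, he]
  · exact TwistedArrow.Hom.ext e.hom_inv_id e.hom_inv_id
  · exact TwistedArrow.Hom.ext e.inv_hom_id e.inv_hom_id
  · apply TwistedArrow.Hom.ext
    · change 𝟙 s.obj = e.hom ≫ 𝟙 t.obj ≫ e.inv
      simp
    · change 𝟙 s.obj = (e.hom ≫ 𝟙 t.obj) ≫ e.inv
      simp

end

section

variable {C : Type u} [Category.{v} C] [Preadditive C] [HasZeroObject C]
  [HasBinaryBiproducts C] [HermitianStructure C]

/-- A sesquilinear form `(M, s)` is hyperbolic if the unimodular hermitian form `F(M, s)` over the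
category of twisted double arrows is hyperbolic. -/
def IsHyperbolic (s : SesqForm C) : Prop := s.toTwisted.IsHermHyperbolic

theorem IsHyperbolic.of_isometric {s t : SesqForm C} (h : Isometric s t) (ht : t.IsHyperbolic) :
    s.IsHyperbolic := by
  obtain ⟨Q, hQ, hi⟩ := ht
  exact ⟨Q, hQ, h.toTwisted.trans hi⟩

/-- The sesquilinear form on `M ⊕ N` given by the off-diagonal matrix with rows `(0, p)` and
`(q, 0)`. -/
noncomputable def offDiag (M N : C) (p : N ⟶ dual M) (q : M ⟶ dual N) : SesqForm C where
  obj := M ⊞ N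
  form := offDiagMat p q

theorem isometric_hyp {s : SesqForm C} {Q : C} (a : s.obj ⟶ Q) (b : s.obj ⟶ dual Q)
    (a' : Q ⟶ s.obj) (b' : dual Q ⟶ s.obj) (haa : a' ≫ a = 𝟙 Q) (hab : a' ≫ b = 0)
    (hba : b' ≫ a = 0) (hbb : b' ≫ b = 𝟙 _) (htot : a ≫ a' + b ≫ b' = 𝟙 _)
    (hs : s.form = b ≫ dualMap a + a ≫ bidual Q ≫ dualMap b) : Isometric s (hyp Q) := by
  refine ⟨⟨biprod.lift a b, biprod.desc a' b', ?_, lift_desc_eq a b a' b' haa hab hba hbb⟩,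
    hs.trans (lift_offDiagMat a b).symm⟩
  rw [← htot]
  exact biprod.lift_desc

theorem offDiag_isHyperbolic (M N : C) (p : N ⟶ dual M) (q : M ⟶ dual N) :
    (offDiag M N p q).IsHyperbolic := by
  let Z : TwistedArrow C := ⟨M, N, bidual M ≫ dualMap p, q⟩
  let X : TwistedArrow C := (offDiag M N p q).toTwisted.obj
  have hf : X.f = offDiagMat (bidual N ≫ dualMap q) (bidual M ≫ dualMap p) :=
    transpose_offDiagMat p q
  have hW : (dual Z).g = p := transpose_transpose p
  let a : X ⟶ Z := TwistedArrow.Hom.mk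
    (biprod.fst : M ⊞ N ⟶ M) (biprod.inr : N ⟶ M ⊞ N)
    (by rw [hf]; exact (offDiagMat_inr _ _).symm) (offDiagMat_inr p q).symm
  let b : X ⟶ dual Z := TwistedArrow.Hom.mk
    (biprod.snd : M ⊞ N ⟶ N) (biprod.inl : M ⟶ M ⊞ N)
    (by rw [hf]; exact (offDiagMat_inl _ _).symm)
    (by rw [hW]; exact (offDiagMat_inl p q).symm)
  let a' : Z ⟶ X := TwistedArrow.Hom.mk
    (biprod.inl : M ⟶ M ⊞ N) (biprod.snd : M ⊞ N ⟶ N)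
    (by rw [hf]; exact inl_offDiagMat _ _) (inl_offDiagMat p q)
  let b' : dual Z ⟶ X := TwistedArrow.Hom.mk
    (biprod.inr : N ⟶ M ⊞ N) (biprod.fst : M ⊞ N ⟶ M)
    (by rw [hf]; exact inr_offDiagMat _ _) (by rw [hW]; exact inr_offDiagMat p q)
  refine ⟨Z, TwistedArrow.isReflexive Z, isometric_hyp a b a' b' ?_ ?_ ?_ ?_ ?_ ?_⟩
  · exact TwistedArrow.Hom.ext biprod.inl_fst biprod.inr_snd
  · exact TwistedArrow.Hom.ext biprod.inl_snd biprod.inl_snd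
  · exact TwistedArrow.Hom.ext biprod.inr_fst biprod.inr_fst
  · exact TwistedArrow.Hom.ext biprod.inr_snd biprod.inl_fst
  · exact TwistedArrow.Hom.ext biprod.total ((add_comm _ _).trans biprod.total)
  · apply TwistedArrow.Hom.ext
    · have h : 𝟙 (M ⊞ N) = biprod.snd ≫ biprod.inr + biprod.fst ≫ 𝟙 M ≫ biprod.inl := by
        rw [Category.id_comp, add_comm, biprod.total]
      exact h
    · have h : 𝟙 (M ⊞ N) = biprod.fst ≫ biprod.inl + (biprod.snd ≫ 𝟙 N) ≫ biprod.inr := by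
        rw [Category.comp_id, biprod.total]
      exact h

theorem IsHermHyperbolic.isHyperbolic {s : SesqForm C} (h : s.IsHermHyperbolic) :
    s.IsHyperbolic := by
  obtain ⟨Q, -, hi⟩ := h
  refine IsHyperbolic.of_isometric hi ?_
  exact offDiag_isHyperbolic Q (dual Q) (𝟙 _) (bidual Q)

end

end SesqForm

/-! ### Witt groups -/

section Witt

variable {C : Type u} [Category.{v} C] [Preadditive C] [HasZeroObject C]
  [HasBinaryBiproducts C] [HermitianStructure C]

namespace SesqForm

theorem Isometric.orthoSum {s s' t t' : SesqForm C} :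
    Isometric s s' → Isometric t t' → Isometric (s.orthoSum t) (s'.orthoSum t') := by
  rintro ⟨e, he⟩ ⟨d, hd⟩
  refine ⟨biprod.mapIso e d, ?_⟩
  simp only [SesqForm.orthoSum, diagMat, he, hd, Preadditive.add_comp, Preadditive.comp_add, Category.assoc,
    ← dualMap_comp, biprod.mapIso_hom, biprod.map_fst, biprod.map_snd, biprod.map_fst_assoc,
    biprod.map_snd_assoc]

theorem orthoSum_comm (s t : SesqForm C) : Isometric (s.orthoSum t) (t.orthoSum s) := by
  refine ⟨biprod.braiding _ _, ?_⟩
  simp only [SesqForm.orthoSum, diagMat, Preadditive.add_comp, Preadditive.comp_add, Category.assoc,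
    ← dualMap_comp, biprod.braiding_hom, biprod.lift_fst, biprod.lift_snd, biprod.lift_fst_assoc,
    biprod.lift_snd_assoc]
  exact add_comm _ _

theorem orthoSum_assoc (s t r : SesqForm C) :
    Isometric ((s.orthoSum t).orthoSum r) (s.orthoSum (t.orthoSum r)) := by
  refine ⟨biprod.associator _ _ _, ?_⟩
  simp only [SesqForm.orthoSum, diagMat, Preadditive.add_comp, Preadditive.comp_add, Category.assoc,
    ← dualMap_comp, biprod.associator_hom, biprod.lift_fst, biprod.lift_snd, biprod.lift_fst_assoc,
    biprod.lift_snd_assoc, add_assoc]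

theorem zeroForm_orthoSum (s : SesqForm C) : Isometric ((zeroForm C).orthoSum s) s := by
  refine ⟨⟨biprod.snd, biprod.inr, ?_, ?_⟩, ?_⟩
  · refine biprod.hom_ext' _ _ ?_ ?_
    · exact (isZero_zero C).eq_of_src _ _
    · change biprod.inr ≫ biprod.snd ≫ biprod.inr = biprod.inr ≫ 𝟙 _
      simp
  · exact biprod.inr_snd
  · simp [SesqForm.orthoSum, diagMat, zeroForm]

theorem zeroForm_isHermitian : (zeroForm C).IsHermitian := (isZero_zero C).eq_of_src _ _

theorem zeroForm_isUnimodular : (zeroForm C).IsUnimodular := by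
  have h : IsZero (dual (0 : C)) := by
    rw [IsZero.iff_id_eq_zero, ← dualMap_id, (isZero_zero C).eq_of_src (𝟙 (0 : C)) 0, dualMap_zero]
  exact ⟨⟨0, (isZero_zero C).eq_of_src _ _, h.eq_of_src _ _⟩,
    ⟨0, (isZero_zero C).eq_of_src _ _, h.eq_of_src _ _⟩⟩

theorem IsHermitian.orthoSum {s t : SesqForm C} (hs : s.IsHermitian) (ht : t.IsHermitian) :
    (s.orthoSum t).IsHermitian := by
  unfold IsHermitian at hs ht
  refine Eq.symm ((transpose_diagMat s.form t.form).trans ?_)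
  rw [← hs, ← ht]
  rfl

theorem IsUnimodular.orthoSum {s t : SesqForm C} (hs : s.IsUnimodular) (ht : t.IsUnimodular) :
    (s.orthoSum t).IsUnimodular := by
  obtain ⟨h1, h2⟩ := hs
  obtain ⟨h3, h4⟩ := ht
  refine ⟨isIso_diagMat s.form t.form, ?_⟩
  have h := isIso_diagMat (bidual s.obj ≫ dualMap s.form) (bidual t.obj ≫ dualMap t.form)
  rw [← transpose_diagMat] at h
  exact h

end SesqForm

variable (C) in
/-- The equivalence relation of isometry. -/
def isometrySetoid : Setoid (SesqForm C) where
  r := SesqForm.Isometric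
  iseqv := ⟨SesqForm.Isometric.refl, SesqForm.Isometric.symm, SesqForm.Isometric.trans⟩

variable (C) in
/-- Isometry classes of sesquilinear forms over `C`. -/
def SesqClass : Type max u v := Quotient (isometrySetoid C)

/-- The isometry class of a sesquilinear form. -/
def SesqForm.cls (s : SesqForm C) : SesqClass C := Quotient.mk (isometrySetoid C) s

theorem SesqForm.cls_eq_iff {s t : SesqForm C} : s.cls = t.cls ↔ s.Isometric t :=
  Quotient.eq (r := isometrySetoid C)

noncomputable instance : Add (SesqClass C) :=
  ⟨Quotient.map₂ SesqForm.orthoSum fun _ _ h _ _ h' => h.orthoSum h'⟩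

noncomputable instance : Zero (SesqClass C) := ⟨(SesqForm.zeroForm C).cls⟩

/-- Isometry classes form a commutative monoid under orthogonal sum. -/
noncomputable instance : AddCommMonoid (SesqClass C) where
  add_assoc := by
    rintro ⟨s⟩ ⟨t⟩ ⟨r⟩
    exact Quotient.sound (SesqForm.orthoSum_assoc s t r)
  add_comm := by
    rintro ⟨s⟩ ⟨t⟩
    exact Quotient.sound (SesqForm.orthoSum_comm s t)
  zero_add := by
    rintro ⟨s⟩
    exact Quotient.sound (SesqForm.zeroForm_orthoSum s)
  add_zero := by
    rintro ⟨s⟩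
    exact Quotient.sound ((SesqForm.orthoSum_comm _ _).trans (SesqForm.zeroForm_orthoSum s))
  nsmul := nsmulRec

theorem SesqForm.cls_add (s t : SesqForm C) : s.cls + t.cls = (s.orthoSum t).cls := rfl

variable (C) in
/-- The monoid of isometry classes of unimodular hermitian forms over `C`. -/
noncomputable def hermClasses : AddSubmonoid (SesqClass C) where
  carrier := {x | ∃ s : SesqForm C, s.IsHermitian ∧ s.IsUnimodular ∧ s.cls = x}
  zero_mem' := ⟨_, SesqForm.zeroForm_isHermitian, SesqForm.zeroForm_isUnimodular, rfl⟩
  add_mem' := by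
    rintro _ _ ⟨s, hs, hs', rfl⟩ ⟨t, ht, ht', rfl⟩
    exact ⟨_, hs.orthoSum ht, hs'.orthoSum ht', rfl⟩

variable (C) in
/-- The Grothendieck group of isometry classes of sesquilinear forms. -/
abbrev SesqGrothendieck : Type max u v := Algebra.GrothendieckAddGroup (SesqClass C)

variable (C) in
/-- The subgroup generated by the hyperbolic sesquilinear forms. -/
noncomputable def sesqHyperbolic : AddSubgroup (SesqGrothendieck C) :=
  AddSubgroup.closure
    {x | ∃ s : SesqForm C, s.IsHyperbolic ∧ x = Algebra.GrothendieckAddGroup.of s.cls}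

variable (C) in
/-- The Witt group `W_S(C)` of sesquilinear forms over `C`. -/
abbrev WittS : Type max u v := SesqGrothendieck C ⧸ sesqHyperbolic C

/-- The class in `W_S(C)` of a sesquilinear form. -/
noncomputable def SesqForm.wittS (s : SesqForm C) : WittS C :=
  QuotientAddGroup.mk (Algebra.GrothendieckAddGroup.of s.cls)

variable (C) in
/-- The Grothendieck group of isometry classes of unimodular hermitian forms. -/
abbrev HermGrothendieck : Type max u v := Algebra.GrothendieckAddGroup (hermClasses C)

variable (C) in
/-- The subgroup generated by the hyperbolic unimodular hermitian forms. -/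
noncomputable def hermHyperbolic : AddSubgroup (HermGrothendieck C) :=
  AddSubgroup.closure
    {x | ∃ (s : SesqForm C) (hs : s.IsHermitian) (hu : s.IsUnimodular), s.IsHermHyperbolic ∧
      x = Algebra.GrothendieckAddGroup.of (⟨s.cls, s, hs, hu, rfl⟩ : hermClasses C)}

variable (C) in
/-- The Witt group `W(C)` of unimodular hermitian forms over `C`. -/
abbrev Witt : Type max u v := HermGrothendieck C ⧸ hermHyperbolic C

/-- The class in `W(C)` of a unimodular hermitian form. -/
noncomputable def SesqForm.witt (s : SesqForm C) (hs : s.IsHermitian) (hu : s.IsUnimodular) :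
    Witt C :=
  QuotientAddGroup.mk (Algebra.GrothendieckAddGroup.of
    (⟨s.cls, s, hs, hu, rfl⟩ : hermClasses C))

variable (C) in
/-- The homomorphism of Grothendieck groups sending the class of a unimodular hermitian form to
its class as a sesquilinear form. -/
noncomputable def hermToSesq : HermGrothendieck C →+ SesqGrothendieck C :=
  Algebra.GrothendieckAddGroup.lift (Algebra.GrothendieckAddGroup.of.comp (hermClasses C).subtype)

theorem hermToSesq_of (x : hermClasses C) :
    hermToSesq C (Algebra.GrothendieckAddGroup.of x)
      = Algebra.GrothendieckAddGroup.of (x : SesqClass C) :=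
  DFunLike.congr_fun (Algebra.GrothendieckAddGroup.lift.symm_apply_apply
    (Algebra.GrothendieckAddGroup.of.comp (hermClasses C).subtype)) x

theorem hermHyperbolic_le : hermHyperbolic C ≤ (sesqHyperbolic C).comap (hermToSesq C) := by
  rw [hermHyperbolic, AddSubgroup.closure_le]
  rintro _ ⟨s, hs, hu, h, rfl⟩
  exact AddSubgroup.subset_closure ⟨s, h.isHyperbolic, hermToSesq_of _⟩

variable (C) in
/-- The homomorphism `W(C) → W_S(C)` sending the class of a unimodular hermitian form to its
class as a sesquilinear form. -/
noncomputable def wittToWittS : Witt C →+ WittS C :=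
  QuotientAddGroup.map _ _ (hermToSesq C) hermHyperbolic_le

theorem wittToWittS_witt (s : SesqForm C) (hs : s.IsHermitian) (hu : s.IsUnimodular) :
    wittToWittS C (s.witt hs hu) = s.wittS :=
  congrArg (QuotientAddGroup.mk (s := sesqHyperbolic C)) (hermToSesq_of _)

end Witt

/-! ### The hypotheses -/

/-- A commutative ring `K` is complete semilocal if `K / Jac(K)` is semisimple and `K` is
complete and separated in its `Jac(K)`-adic topology. -/
def IsCompleteSemilocal (K : Type w) [CommRing K] : Prop :=
  IsSemisimpleRing (K ⧸ Ring.jacobson K) ∧ IsAdicComplete (Ring.jacobson K) K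

/-- A `K`-category with a hermitian structure is a `K`-linear hermitian category if `*` is
`K`-linear on morphisms. -/
def IsLinearHermitian (K : Type w) [CommRing K] (C : Type u) [Category.{v} C] [Preadditive C]
    [Linear K C] [HermitianStructure C] : Prop :=
  ∀ (X Y : C) (a : K) (f : X ⟶ Y), dualMap (a • f) = a • dualMap f

end HermCat

/-! Hyperbolicity is a statement about idempotents in a ring with involution. Let E be the
endomorphism ring of the twisted arrow underlying F(M, s). Its elements are pairs (a, b) of
endomorphisms of M adjoint to each other for s on both sides, and σ(a, b) = (b, a) is an involution.
As idempotents of the category split, (M, s) is hyperbolic exactly when E contains an idempotent e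
with σ(e) = 1 - e (`IsHyperbolic.exists_idem`, `IsHyperbolicIdem.isHyperbolic`). For a unimodular
hermitian form the same idempotent gives hyperbolicity in the strict sense
(`IsHyperbolicIdem.isHermHyperbolic`), which is why injectivity follows from the first assertion.

If s has trivial class, then c ⊥ s ⊥ t₁ is isometric to c ⊥ t₂ with t₁, t₂ hyperbolic. Adding -c and
using that c ⊥ -c is hyperbolic (`diagMat_neg_comm`, where 2 is inverted) gives a hyperbolic t with
s ⊥ t hyperbolic. It remains to cancel t (`IsHyperbolicIdem.cancel`). In the ring E of s ⊥ t this
becomes: given a Lagrangian idempotent e, the symmetric projection p onto s and a Lagrangian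
idempotent f of the complement, find an idempotent g in pEp with σ(g) = p - g. Over a semisimple
ring this is Lagrangian reduction (`exists_idempotent_of_semisimple`). In general one solves modulo
the Jacobson radical and lifts the solution compatibly with σ (`IsInvolution.exists_idempotent`).

This requires E to be semilocal with idempotents lifting. Over a complete semilocal K, E is a finite
K-algebra and Newton iteration converges. In the semiprimary case, E is closed under inverses in
End(M) × End(M)ᵒᵖ, hence semilocal by Camps–Dicks; group inverses of powers also stay in E, which
makes its radical nil. -/

namespace HermCat

/-! ### Units and the Jacobson radical -/

section Radical

variable {S : Type*} [Ring S]

theorem isUnit_of_mul_eq_one {a b c : S} (h : b * a = 1) (h' : a * c = 1) : IsUnit a :=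
  ⟨⟨a, b, by rw [left_inv_eq_right_inv h h', h'], h⟩, rfl⟩

/-- The inverse of 1 - ba is 1 + b(1 - ab)⁻¹a. -/
theorem isUnit_one_sub_mul_comm {a b : S} (h : IsUnit (1 - a * b)) : IsUnit (1 - b * a) := by
  obtain ⟨u, hu⟩ := h
  have h1 : (1 - a * b) * (u⁻¹ : Sˣ) = 1 := by rw [← hu]; exact u.mul_inv
  have h2 : (u⁻¹ : Sˣ) * (1 - a * b) = 1 := by rw [← hu]; exact u.inv_mul
  generalize ((u⁻¹ : Sˣ) : S) = v at h1 h2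
  refine isUnit_of_mul_eq_one (b := 1 + b * v * a) (c := 1 + b * v * a) ?_ ?_
  · calc (1 + b * v * a) * (1 - b * a) = 1 - b * a + b * (v * (1 - a * b)) * a := by noncomm_ring
      _ = 1 := by rw [h2]; noncomm_ring
  · calc (1 - b * a) * (1 + b * v * a) = 1 - b * a + b * ((1 - a * b) * v) * a := by noncomm_ring
      _ = 1 := by rw [h1]; noncomm_ring

theorem mem_jacobson_iff_isUnit {x : S} :
    x ∈ Ring.jacobson S ↔ ∀ y, IsUnit (1 - y * x) := by
  rw [← Ideal.jacobson_bot, Ideal.mem_jacobson_iff]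
  constructor
  · intro h y
    have key : ∀ y, ∃ z, z * (1 - y * x) = 1 := fun y => by
      obtain ⟨z, hz⟩ := h (-y)
      refine ⟨z, ?_⟩
      rw [Submodule.mem_bot] at hz
      rw [← sub_eq_zero, ← hz]
      noncomm_ring
    obtain ⟨z, hz⟩ := key y
    -- The left inverse z equals 1 + zyx, so it is again of the form that has a left inverse; hence
    -- z is invertible on both sides.
    obtain ⟨z', hz'⟩ := key (-(z * y))
    have h1 : 1 - -(z * y) * x = z := by
      calc 1 - -(z * y) * x = 1 + z * y * x := by noncomm_ring
        _ = z * (1 - y * x) + z * y * x := by rw [hz]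
        _ = z := by noncomm_ring
    rw [h1] at hz'
    have h2 : z' = 1 - y * x := left_inv_eq_right_inv hz' hz
    exact isUnit_of_mul_eq_one hz (h2 ▸ hz')
  · intro h y
    obtain ⟨u, hu⟩ := h (-y)
    refine ⟨(u⁻¹ : Sˣ), ?_⟩
    rw [Submodule.mem_bot, sub_eq_zero]
    calc ((u⁻¹ : Sˣ) : S) * y * x + (u⁻¹ : Sˣ) = (u⁻¹ : Sˣ) * (1 - -y * x) := by noncomm_ring
      _ = 1 := by rw [← hu]; exact u.inv_mul

theorem isUnit_one_add_of_mem_jacobson {x : S} (hx : x ∈ Ring.jacobson S) : IsUnit (1 + x) := by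
  simpa using mem_jacobson_iff_isUnit.mp hx (-1)

theorem le_jacobson_of_isUnit {I : Ideal S} (h : ∀ x ∈ I, IsUnit (1 - x)) :
    I ≤ Ring.jacobson S := fun _ hx =>
  mem_jacobson_iff_isUnit.mpr fun y => h _ (I.mul_mem_left y hx)

theorem eq_zero_of_isIdempotentElem_of_mem_jacobson {e : S} (he : e * e = e)
    (h : e ∈ Ring.jacobson S) : e = 0 := by
  have hu := mem_jacobson_iff_isUnit.mp h 1
  refine hu.mul_left_cancel ?_
  rw [one_mul, sub_mul, one_mul, he, sub_self, mul_zero]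

/-- Two commuting idempotents that agree modulo the radical are equal. -/
theorem eq_of_commute_idempotents {e f : S} (he : e * e = e) (hf : f * f = f)
    (hc : e * f = f * e) (h : e - f ∈ Ring.jacobson S) : e = f := by
  -- For commuting idempotents (e - f)² is idempotent and (e - f)³ = e - f. An idempotent in the
  -- radical vanishes, so (e - f)² = 0 and e - f = 0.
  have h1 : (e - f) * (e - f) * ((e - f) * (e - f)) = (e - f) * (e - f) := by
    have h2 : (e - f) * (e - f) = e + f - 2 * (e * f) := by
      simp only [sub_mul, mul_sub, he, hf, ← hc]; noncomm_ring
    have h3 : e * (e * f) = e * f := by rw [← mul_assoc, he]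
    have h4 : f * (e * f) = e * f := by rw [hc, ← mul_assoc, hf]
    have h5 : e * f * (e * f) = e * f := by rw [mul_assoc, h4, h3]
    have h6 : e * f * e = e * f := by rw [mul_assoc, ← hc, h3]
    have h7 : e * f * f = e * f := by rw [mul_assoc, hf]
    rw [h2]
    simp only [two_mul, sub_mul, mul_sub, add_mul, mul_add, he, hf, ← hc, h3, h4, h5, h6, h7]
    abel
  have h2 := eq_zero_of_isIdempotentElem_of_mem_jacobson h1 (Ideal.mul_mem_left _ _ h)
  have h3 : (e - f) * (e - f) * (e - f) = e - f := by
    have h4 : e * f * e = e * f := by rw [mul_assoc, ← hc, ← mul_assoc, he]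
    have h5 : f * e * f = e * f := by rw [← hc, mul_assoc, hf]
    have h6 : e * f * f = e * f := by rw [mul_assoc, hf]
    have h7 : f * e * e = e * f := by rw [mul_assoc, he, hc]
    simp only [sub_mul, mul_sub, he, hf, h4, h5, h6, h7]
    rw [← hc]
    abel
  rw [h2, zero_mul] at h3
  exact sub_eq_zero.mp h3.symm

end Radical

/-! ### A criterion for a ring to be semilocal -/

section CampsDicks

variable {S : Type*} [Ring S]

/-- The Camps–Dicks criterion for semilocal rings. -/
theorem isSemisimpleRing_quotient_jacobson_of_rank {P : Type*} [PartialOrder P] [WellFoundedGT P]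
    (d : S → P) (hle : ∀ a b, d b ≤ d (b - b * a * b))
    (heq : ∀ a b, d b = d (b - b * a * b) → IsUnit (1 - a * b)) :
    IsSemisimpleRing (S ⧸ Ring.jacobson S) := by
  -- Choose x in 1 + I of maximal rank. If cx ∈ I, then x - x(yc)x is again in 1 + I, so its rank
  -- cannot grow and 1 - ycx is a unit for every y. Modulo the radical, x therefore generates a
  -- complement of I.
  have key : ∀ I : Ideal S, ∃ x : S, 1 - x ∈ I ∧ ∀ c, c * x ∈ I → c * x ∈ Ring.jacobson S := by
    intro I
    obtain ⟨p, ⟨x, hx, rfl⟩, hmax⟩ := (wellFounded_gt (α := P)).has_min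
      (d '' {x | 1 - x ∈ I}) ⟨_, 1, by simp, rfl⟩
    refine ⟨x, hx, fun c hc => ?_⟩
    refine mem_jacobson_iff_isUnit.mpr fun y => ?_
    rw [← mul_assoc]
    refine heq _ _ (eq_of_le_of_not_lt (hle _ _) fun hlt => hmax _ ⟨_, ?_, rfl⟩ hlt)
    change 1 - (x - x * (y * c) * x) ∈ I
    have : 1 - (x - x * (y * c) * x) = (1 - x) + x * y * (c * x) := by noncomm_ring
    rw [this]
    exact I.add_mem hx (I.mul_mem_left _ hc)
  refine (isSemisimpleModule_iff _ _).mpr ⟨fun I => ?_⟩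
  let I : Ideal (S ⧸ Ring.jacobson S) := I
  obtain ⟨x, hx, h⟩ := key (I.comap (Ideal.Quotient.mk _))
  refine ⟨Ideal.span {Ideal.Quotient.mk _ x}, ?_, ?_⟩
  · rw [Submodule.disjoint_def]
    intro z hz hz'
    obtain ⟨c, rfl⟩ := Ideal.mem_span_singleton'.mp hz'
    obtain ⟨c, rfl⟩ := Ideal.Quotient.mk_surjective c
    rw [← map_mul] at hz ⊢
    exact Ideal.Quotient.eq_zero_iff_mem.mpr (h c hz)
  · rw [codisjoint_iff]
    refine (Ideal.eq_top_iff_one _).mpr ?_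
    rw [← sub_add_cancel 1 (Ideal.Quotient.mk _ x)]
    refine Submodule.add_mem_sup ?_ (Ideal.mem_span_singleton_self _)
    simpa using hx

theorem isUnit_of_mul_right_injective [IsArtinianRing S] {a : S}
    (h : ∀ x, x * a = 0 → x = 0) : IsUnit a := by
  have hinj : Function.Injective (LinearMap.toSpanSingleton S S a) := by
    rw [← LinearMap.ker_eq_bot, LinearMap.ker_eq_bot']
    exact fun x hx => h x hx
  obtain ⟨y, hy⟩ := IsArtinian.surjective_of_injective_endomorphism _ hinj 1
  change y * a = 1 at hy
  refine isUnit_of_mul_eq_one hy (c := y) (sub_eq_zero.mp (h _ ?_))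
  rw [sub_mul, mul_assoc, hy, mul_one, one_mul, sub_self]

theorem ker_toSpanSingleton_le (a b : S) :
    LinearMap.ker (LinearMap.toSpanSingleton S S b) ≤
      LinearMap.ker (LinearMap.toSpanSingleton S S (b - b * a * b)) := by
  intro x hx
  rw [LinearMap.mem_ker, LinearMap.toSpanSingleton_apply, smul_eq_mul] at hx ⊢
  rw [mul_sub, ← mul_assoc, ← mul_assoc, hx]
  simp

/-- With left annihilators as rank this is the equality case of the Camps–Dicks criterion: if x(1 -
ba) = 0, then x kills b - bab, hence b, so x = xba = 0. -/
theorem isUnit_one_sub_of_ker_eq [IsArtinianRing S] (a b : S)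
    (h : LinearMap.ker (LinearMap.toSpanSingleton S S b) =
      LinearMap.ker (LinearMap.toSpanSingleton S S (b - b * a * b))) : IsUnit (1 - a * b) := by
  refine isUnit_one_sub_mul_comm (isUnit_of_mul_right_injective fun x hx => ?_)
  have h1 : x ∈ LinearMap.ker (LinearMap.toSpanSingleton S S (b - b * a * b)) := by
    rw [LinearMap.mem_ker, LinearMap.toSpanSingleton_apply, smul_eq_mul]
    calc x * (b - b * a * b) = x * (1 - b * a) * b := by noncomm_ring
      _ = 0 := by rw [hx, zero_mul]
  rw [← h, LinearMap.mem_ker, LinearMap.toSpanSingleton_apply, smul_eq_mul] at h1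
  calc x = x * (1 - b * a) + x * b * a := by noncomm_ring
    _ = 0 := by rw [hx, h1]; simp

theorem isUnit_of_isUnit_quotient_jacobson {a : S}
    (h : IsUnit (Ideal.Quotient.mk (Ring.jacobson S) a)) : IsUnit a := by
  obtain ⟨u, hu⟩ := h
  obtain ⟨b, hb⟩ := Ideal.Quotient.mk_surjective ((u⁻¹ : (S ⧸ Ring.jacobson S)ˣ) : S ⧸ Ring.jacobson S)
  have h1 : IsUnit (a * b) := by
    have : a * b - 1 ∈ Ring.jacobson S := by
      rw [← Ideal.Quotient.eq, map_mul, hb, ← hu, map_one]; exact u.mul_inv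
    simpa using isUnit_one_add_of_mem_jacobson this
  have h2 : IsUnit (b * a) := by
    have : b * a - 1 ∈ Ring.jacobson S := by
      rw [← Ideal.Quotient.eq, map_mul, hb, ← hu, map_one]; exact u.inv_mul
    simpa using isUnit_one_add_of_mem_jacobson this
  obtain ⟨v, hv⟩ := h1
  obtain ⟨w, hw⟩ := h2
  refine isUnit_of_mul_eq_one (b := (w⁻¹ : Sˣ) * b) (c := b * (v⁻¹ : Sˣ)) ?_ ?_
  · rw [mul_assoc, ← hw]; exact w.inv_mul
  · rw [← mul_assoc, ← hv]; exact v.mul_inv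

end CampsDicks

/-! ### Rings with involution -/

section Involution

/-- An additive involution of a ring that reverses products. -/
structure IsInvolution {S : Type*} [Ring S] (σ : S →+ S) : Prop where
  mul : ∀ a b, σ (a * b) = σ b * σ a
  invol : ∀ a, σ (σ a) = a

variable {A : Type*} [Ring A] {σ : A →+ A}

theorem IsInvolution.one (hσ : IsInvolution σ) : σ 1 = 1 := by
  have h := hσ.mul 1 (σ 1)
  rw [one_mul, hσ.invol, one_mul] at h
  exact h.symm

/-- Double orthogonals for the pairing xσ(y): with I = Ae, testing against the single element 1 -
σ(e) of the orthogonal gives y = ye. -/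
theorem IsInvolution.orth_orth_le [IsSemisimpleRing A] (hσ : IsInvolution σ) (I : Ideal A)
    {y : A} (hy : ∀ z, (∀ x ∈ I, x * σ z = 0) → z * σ y = 0) : y ∈ I := by
  obtain ⟨e, he, rfl⟩ := IsSemisimpleRing.ideal_eq_span_idempotent I
  have h := hy (1 - σ e) fun x hx => by
    obtain ⟨c, rfl⟩ := Ideal.mem_span_singleton'.mp hx
    rw [map_sub, hσ.one, hσ.invol, mul_assoc, mul_sub, mul_one, he.eq, sub_self, mul_zero]
  have h2 := congrArg σ h
  rw [hσ.mul, hσ.invol, map_sub, hσ.one, hσ.invol, map_zero, mul_sub, mul_one, sub_eq_zero] at h2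
  exact Ideal.mem_span_singleton'.mpr ⟨y, h2.symm⟩

/-- Over a semisimple ring, an orthogonal summand of a hyperbolic form with a hyperbolic
complement is hyperbolic. -/
theorem IsInvolution.exists_idempotent_of_semisimple [IsSemisimpleRing A] (hσ : IsInvolution σ)
    {t : A} (ht : t + t = 1) {e p f : A} (he : e * e = e) (hσe : σ e = 1 - e) (hp : p * p = p)
    (hσp : σ p = p) (hf : f * f = f) (hσf : σ f = 1 - p - f) (hpf : p * f = 0) (hfp : f * p = 0) :
    ∃ g, g * g = g ∧ p * g = g ∧ g * p = g ∧ σ g = p - g := by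
  -- For the pairing xσ(y), L is its own orthogonal, I is isotropic and the orthogonal of I is A(p +
  -- f). Thus Ap plays the role of I^⊥/I, and the Lagrangian sought there is the image of X = L ∩
  -- I^⊥.
  let L : Ideal A := Ideal.span {e}
  let I : Ideal A := Ideal.span {f}
  let X : Ideal A := L ⊓ Ideal.span {p + f}
  have hL : ∀ x, x ∈ L ↔ x * e = x := fun x => Ideal.mem_span_singleton'.trans
    ⟨by rintro ⟨c, rfl⟩; rw [mul_assoc, he], fun h => ⟨x, h⟩⟩
  have hpf2 : (p + f) * (p + f) = p + f := by
    simp only [mul_add, add_mul, hp, hf, hpf, hfp, add_zero, zero_add]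
  have hI : ∀ x, x ∈ Ideal.span {p + f} ↔ x * (p + f) = x := fun x =>
    Ideal.mem_span_singleton'.trans
    ⟨by rintro ⟨c, rfl⟩; rw [mul_assoc, hpf2], fun h => ⟨x, h⟩⟩
  have hLL : ∀ l ∈ L, ∀ m ∈ L, l * σ m = 0 := by
    intro l hl m hm
    rw [← (hL l).mp hl, ← (hL m).mp hm, hσ.mul, hσe]
    calc l * e * ((1 - e) * σ m) = l * (e - e * e) * σ m := by noncomm_ring
      _ = 0 := by rw [he]; simp
  have hpσf : p * σ f = 0 := by rw [hσf, mul_sub, mul_sub, mul_one, hp, hpf]; simp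
  have hfσf : f * σ f = 0 := by rw [hσf, mul_sub, mul_sub, mul_one, hf, hfp]; simp
  -- On A(p + f) the pairing sees only the components in Ap, because fp, pσ(f) and fσ(f) vanish.
  have hXX : ∀ l ∈ X, ∀ m ∈ X, l * p * σ m = 0 := by
    intro l hl m hm
    have h := hLL l hl.1 m hm.1
    have e1 := (hI l).mp hl.2
    have e2 := (hI m).mp hm.2
    have e3 : σ m = p * σ m + σ f * σ m := by
      conv_lhs => rw [← e2]
      rw [hσ.mul, map_add, hσp, add_mul]
    have e4 : l * p * σ m = l * (p + f) * (p * σ m + σ f * σ m) := by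
      calc l * p * σ m = l * p * (p * σ m + σ f * σ m) := by rw [← e3]
        _ = l * (p * p + f * p + p * σ f + f * σ f) * σ m - l * f * p * σ m
            - l * (f * σ f) * σ m := by noncomm_ring
        _ = l * (p * p + f * p + p * σ f + f * σ f) * σ m := by
            rw [mul_assoc l f p, hfp, hfσf]; simp
        _ = l * (p + f) * (p * σ m + σ f * σ m) := by noncomm_ring
    rw [e4, ← e3, e1, h]
  let N : Ideal A := Submodule.map (LinearMap.toSpanSingleton A A p) X
  have hN : ∀ x, x ∈ N ↔ ∃ l ∈ X, l * p = x := fun x => Iff.rfl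
  -- N contains its orthogonal in Ap: such a y is orthogonal to X = (L + I)^⊥, so y ∈ L + I, and
  -- subtracting the I-part leaves an element of X whose image is y.
  have hmax : ∀ y, y * p = y → (∀ x ∈ N, x * σ y = 0) → y ∈ N := by
    intro y hy h
    have hyL : y ∈ L ⊔ I := by
      refine hσ.orth_orth_le _ fun z hz => ?_
      have hz1 : z ∈ L := by
        have h1 := congrArg σ (hz e (Submodule.mem_sup_left (Ideal.mem_span_singleton_self e)))
        rw [hσ.mul, hσ.invol, map_zero, hσe, mul_sub, mul_one, sub_eq_zero] at h1
        exact (hL z).mpr h1.symm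
      have hz2 : z ∈ Ideal.span {p + f} := by
        rw [hI]
        have h1 := congrArg σ (hz f (Submodule.mem_sup_right (Ideal.mem_span_singleton_self f)))
        rw [hσ.mul, hσ.invol, map_zero, hσf] at h1
        rw [← sub_eq_zero, ← neg_eq_zero, ← h1]
        noncomm_ring
      have h3 := h (z * p) ⟨z, ⟨hz1, hz2⟩, rfl⟩
      rw [← hy, hσ.mul, hσp, ← mul_assoc]
      rw [← hy, hσ.mul, hσp, mul_assoc, ← mul_assoc p, hp, ← mul_assoc] at h3
      exact h3
    obtain ⟨l, hl, i, hi, hli⟩ := Submodule.mem_sup.mp hyL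
    obtain ⟨c, rfl⟩ := Ideal.mem_span_singleton'.mp hi
    refine ⟨l, ⟨hl, (hI l).mpr ?_⟩, ?_⟩
    · rw [eq_sub_of_add_eq hli, sub_mul, mul_assoc c, mul_add f, hfp, hf, zero_add, mul_add,
        hy, ← hy, mul_assoc y p f, hpf, mul_zero, add_zero]
    · change l * p = y
      rw [eq_sub_of_add_eq hli, sub_mul, hy, mul_assoc, hfp, mul_zero, sub_zero]
  obtain ⟨g₀, hg₀, hNg⟩ := IsSemisimpleRing.ideal_eq_span_idempotent N
  have hg₀N : g₀ ∈ N := hNg ▸ Ideal.mem_span_singleton_self g₀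
  have hg₀p : g₀ * p = g₀ := by
    obtain ⟨l, -, h⟩ := (hN g₀).mp hg₀N
    rw [← h, mul_assoc, hp]
  have hg₀σ : g₀ * σ g₀ = 0 := by
    obtain ⟨l, hl, h⟩ := (hN g₀).mp hg₀N
    rw [← h, hσ.mul, hσp, ← mul_assoc, mul_assoc l, hp]
    exact hXX l hl l hl
  have hgp : p * g₀ * p = p * g₀ := by rw [mul_assoc, hg₀p]
  have hpg : p * (p * g₀) = p * g₀ := by rw [← mul_assoc, hp]
  have hgg : p * g₀ * (p * g₀) = p * g₀ := by rw [← mul_assoc, hgp, mul_assoc, hg₀.eq]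
  have hgσ : p * g₀ * σ (p * g₀) = 0 := by
    rw [hσ.mul, hσp, ← mul_assoc, mul_assoc p, hg₀σ]; simp
  -- The element p - σ(g), with g = p * g₀, is orthogonal to N, hence lies in N. This yields g +
  -- σ(g) - σ(g)g = p, which misses the required identity only by the symmetric term σ(g)g.
  have hg1 : (p - σ (p * g₀)) * (p * g₀) = p - σ (p * g₀) := by
    have h1 : p - σ (p * g₀) ∈ N := by
      refine hmax _ ?_ fun x hx => ?_
      · rw [sub_mul, hp]
        congr 1
        calc σ (p * g₀) * p = σ (p * (p * g₀)) := by rw [hσ.mul p (p * g₀), hσp]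
          _ = σ (p * g₀) := by rw [hpg]
      · rw [hNg] at hx
        obtain ⟨c, rfl⟩ := Ideal.mem_span_singleton'.mp hx
        rw [map_sub, hσp, hσ.invol, mul_assoc, mul_sub, hg₀p, ← mul_assoc, hg₀p, hg₀.eq, sub_self,
          mul_zero]
    have h2 : (p - σ (p * g₀)) * g₀ = p - σ (p * g₀) := by
      rw [hNg] at h1
      obtain ⟨c, hc⟩ := Ideal.mem_span_singleton'.mp h1
      rw [← hc, mul_assoc, hg₀.eq]
    conv_lhs => rw [← h2, mul_assoc, ← mul_assoc g₀, hg₀p, hg₀.eq, h2]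
  generalize p * g₀ = g at hgp hpg hgg hgσ hg1
  have hsg : σ g * p = σ g := by
    calc σ g * p = σ (p * g) := by rw [hσ.mul, hσp]
      _ = σ g := by rw [hpg]
  have hps : p * σ g = σ g := by
    calc p * σ g = σ (g * p) := by rw [hσ.mul, hσp]
      _ = σ g := by rw [hgp]
  have hσt : σ t = t := by
    have h1 : σ t + σ t = 1 := by rw [← map_add, ht, hσ.one]
    calc σ t = (t + t) * σ t := by rw [ht, one_mul]
      _ = t * (σ t + σ t) := by noncomm_ring
      _ = t := by rw [h1, mul_one]
  have htc : ∀ x, t * x = x * t := fun x => by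
    calc t * x = t * x * (t + t) := by rw [ht, mul_one]
      _ = (t + t) * x * t := by noncomm_ring
      _ = x * t := by rw [ht, one_mul]
  have hsum : g + σ g - σ g * g = p := by
    rw [sub_mul, hpg] at hg1
    rw [add_sub_right_comm, hg1, sub_add_cancel]
  have hgsg : g * (σ g * g * t) = 0 := by rw [← mul_assoc, ← mul_assoc, hgσ]; simp
  -- Subtracting half of the symmetric defect σ(g)g distributes it evenly between g and σ(g).
  refine ⟨g - σ g * g * t, ?_, ?_, ?_, ?_⟩
  · have h1 : σ g * g * t * g = σ g * g * t := by
      rw [mul_assoc, htc, ← mul_assoc, mul_assoc (σ g), hgg]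
    have h2 : σ g * g * t * (σ g * g * t) = 0 := by
      rw [mul_assoc (σ g * g), ← mul_assoc t, htc, mul_assoc _ t, mul_assoc (σ g), ← mul_assoc g,
        ← mul_assoc g, hgσ]
      simp
    rw [sub_mul, mul_sub, mul_sub, hgg, hgsg, h1, h2]
    abel
  · rw [mul_sub, hpg, ← mul_assoc, ← mul_assoc, hps]
  · rw [sub_mul, hgp, mul_assoc, htc, ← mul_assoc, mul_assoc (σ g), hgp]
  · rw [map_sub, hσ.mul, hσ.mul, hσ.invol, hσt, htc, ← hsum]
    have h1 : σ g * g * t + σ g * g * t = σ g * g := by rw [← mul_add, ht, mul_one]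
    nth_rw 2 [← h1]
    abel

end Involution

end HermCat

namespace HermCat

/-! ### Lifting from the semisimple quotient, compatibly with the involution -/

section Lifting

variable {S : Type*} [Ring S]

variable (S) in
/-- Idempotents of `S` modulo the Jacobson radical lift to idempotents of `S`, and the lift of `f`
can be chosen to commute with everything that commutes with `f`. -/
def LiftsIdempotents : Prop :=
  ∀ f : S, f * f - f ∈ Ring.jacobson S →
    ∃ e, e * e = e ∧ e - f ∈ Ring.jacobson S ∧ ∀ c, c * f = f * c → c * e = e * c

variable {σ : S →+ S}

theorem IsInvolution.isUnit (hσ : IsInvolution σ) {a : S} (h : IsUnit a) : IsUnit (σ a) := by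
  obtain ⟨u, rfl⟩ := h
  refine isUnit_of_mul_eq_one (b := σ (u⁻¹ : Sˣ)) (c := σ (u⁻¹ : Sˣ)) ?_ ?_
  · rw [← hσ.mul, u.mul_inv, hσ.one]
  · rw [← hσ.mul, u.inv_mul, hσ.one]

theorem IsInvolution.mem_jacobson (hσ : IsInvolution σ) {a : S} (h : a ∈ Ring.jacobson S) :
    σ a ∈ Ring.jacobson S := by
  refine mem_jacobson_iff_isUnit.mpr fun y => ?_
  have h1 := hσ.isUnit (isUnit_one_sub_mul_comm (mem_jacobson_iff_isUnit.mp h (σ y)))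
  rwa [map_sub, hσ.one, hσ.mul, hσ.invol] at h1

/-- The involution induced on the quotient by the Jacobson radical. -/
def IsInvolution.quotientMap (hσ : IsInvolution σ) :
    S ⧸ Ring.jacobson S →+ S ⧸ Ring.jacobson S :=
  QuotientAddGroup.map _ _ σ fun _ h => hσ.mem_jacobson h

theorem IsInvolution.quotientMap_mk (hσ : IsInvolution σ) (a : S) :
    hσ.quotientMap (Ideal.Quotient.mk _ a) = Ideal.Quotient.mk _ (σ a) := rfl

theorem IsInvolution.quotient (hσ : IsInvolution σ) : IsInvolution hσ.quotientMap where
  mul a b := by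
    obtain ⟨a, rfl⟩ := Ideal.Quotient.mk_surjective a
    obtain ⟨b, rfl⟩ := Ideal.Quotient.mk_surjective b
    rw [← map_mul, quotientMap_mk, hσ.mul, map_mul]
    rfl
  invol a := by
    obtain ⟨a, rfl⟩ := Ideal.Quotient.mk_surjective a
    rw [quotientMap_mk, quotientMap_mk, hσ.invol]

/-- Over a semilocal ring whose idempotents lift, an orthogonal summand of a hyperbolic form with
a hyperbolic complement is hyperbolic. -/
theorem IsInvolution.exists_idempotent (hσ : IsInvolution σ)
    (hS : IsSemisimpleRing (S ⧸ Ring.jacobson S)) (hlift : LiftsIdempotents S)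
    {t : S} (ht : t + t = 1) {e p f : S} (he : e * e = e) (hσe : σ e = 1 - e) (hp : p * p = p)
    (hσp : σ p = p) (hf : f * f = f) (hσf : σ f = 1 - p - f) (hpf : p * f = 0) (hfp : f * p = 0) :
    ∃ g, g * g = g ∧ p * g = g ∧ g * p = g ∧ σ g = p - g := by
  let π := Ideal.Quotient.mk (Ring.jacobson S)
  obtain ⟨g, h1, h2, h3, h4⟩ := hσ.quotient.exists_idempotent_of_semisimple (t := π t) (e := π e)
    (p := π p) (f := π f) (by rw [← map_add, ht, map_one]) (by rw [← map_mul, he])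
    (by rw [quotientMap_mk, hσe, map_sub, map_one]) (by rw [← map_mul, hp])
    (by rw [quotientMap_mk, hσp]) (by rw [← map_mul, hf])
    (by rw [quotientMap_mk, hσf, map_sub, map_sub, map_one]) (by rw [← map_mul, hpf, map_zero])
    (by rw [← map_mul, hfp, map_zero])
  obtain ⟨f₀, rfl⟩ := Ideal.Quotient.mk_surjective g
  have hσt : σ t = t := by
    have h1 : σ t + σ t = 1 := by rw [← map_add, ht, hσ.one]
    calc σ t = (t + t) * σ t := by rw [ht, one_mul]
      _ = t * (σ t + σ t) := by noncomm_ring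
      _ = t := by rw [h1, mul_one]
  have htc : ∀ x, t * x = x * t := fun x => by
    calc t * x = t * x * (t + t) := by rw [ht, mul_one]
      _ = (t + t) * x * t := by noncomm_ring
      _ = x * t := by rw [ht, one_mul]
  obtain ⟨a, ha⟩ : ∃ a, a = p * f₀ * p := ⟨_, rfl⟩
  have hap : a * p = a := by rw [ha, mul_assoc, hp]
  have hpa : p * a = a := by rw [ha, ← mul_assoc, ← mul_assoc, hp]
  have hπa : π a = π f₀ := by rw [ha, map_mul, map_mul, h2, h3]
  have hσap : σ a * p = σ a := by
    calc σ a * p = σ (p * a) := by rw [hσ.mul, hσp]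
      _ = σ a := by rw [hpa]
  have hpσa : p * σ a = σ a := by
    calc p * σ a = σ (a * p) := by rw [hσ.mul, hσp]
      _ = σ a := by rw [hap]
  -- An arbitrary lift a is corrected to b = ½(a + p - σ(a)), which has the same residue and
  -- satisfies σ(b) = p - b exactly.
  obtain ⟨b, hb⟩ : ∃ b, b = t * (a + p - σ a) := ⟨_, rfl⟩
  have hσb : σ b = p - b := by
    have h5 : p = t * p + t * p := by rw [← add_mul, ht, one_mul]
    rw [hb, hσ.mul, map_sub, map_add, hσ.invol, hσp, hσt, ← htc, mul_sub, mul_sub, mul_add, mul_add]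
    nth_rw 2 [h5]
    abel
  have hbp : b * p = b := by rw [hb, mul_assoc, sub_mul, add_mul, hap, hp, hσap]
  have hpb : p * b = b := by rw [hb, ← mul_assoc, ← htc, mul_assoc, mul_sub, mul_add, hpa, hp, hpσa]
  have hπb : π b = π f₀ := by
    have h5 : π (σ a) = π p - π a := by
      rw [← hσ.quotientMap_mk]
      change hσ.quotientMap (π a) = _
      rw [hπa, h4]
    rw [hb, map_mul, map_sub, map_add, h5, hπa]
    calc π t * (π f₀ + π p - (π p - π f₀)) = (π t + π t) * π f₀ := by noncomm_ring
      _ = π f₀ := by rw [← map_add, ht, map_one, one_mul]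
  obtain ⟨e', he', heb, hc⟩ := hlift b (by
    rw [← Ideal.Quotient.eq, map_mul]
    change π b * π b = π b
    rw [hπb, h1])
  -- Since σ(b) = p - b, the commutation clause passes to σ(e'); in particular e', σ(e') and p
  -- commute with each other.
  have hσe'c : ∀ c, c * p = p * c → c * b = b * c → c * σ e' = σ e' * c := by
    intro c hcp hcb
    have h5 : σ c * p = p * σ c := by
      have := congrArg σ hcp
      rw [hσ.mul, hσ.mul, hσp] at this
      exact this.symm
    have h6 : σ c * b = b * σ c := by
      have := congrArg σ hcb
      rw [hσ.mul, hσ.mul, hσb, sub_mul, mul_sub, h5] at this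
      exact (sub_right_injective this).symm
    have h7 := congrArg σ (hc _ h6)
    rw [hσ.mul, hσ.mul, hσ.invol] at h7
    exact h7.symm
  have hpe : p * e' = e' * p := hc p (by rw [hpb, hbp])
  have hpσe : p * σ e' = σ e' * p := hσe'c p rfl (by rw [hpb, hbp])
  have heσe : e' * σ e' = σ e' * e' := hσe'c e' hpe.symm (hc b rfl).symm
  have hσe' : σ e' * σ e' = σ e' := by rw [← hσ.mul, he']
  have hidem : e' * p * (e' * p) = e' * p := by
    rw [mul_assoc, ← mul_assoc p, hpe, mul_assoc e' p, hp, ← mul_assoc, he']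
  have hpep : p * (e' * p) = e' * p := by rw [← mul_assoc, hpe, mul_assoc, hp]
  refine ⟨e' * p, hidem, hpep, by rw [mul_assoc, hp], ?_⟩
  rw [hσ.mul, hσp]
  -- Both sides are commuting idempotents with the same residue, so the identity modulo the radical
  -- is an identity in S.
  refine eq_of_commute_idempotents ?_ ?_ ?_ ?_
  · rw [mul_assoc, ← mul_assoc (σ e'), ← hpσe, mul_assoc p (σ e'), hσe', ← mul_assoc, hp]
  · rw [sub_mul, mul_sub, mul_sub, hp, hpep, hidem, mul_assoc, hp]
    abel
  · have h5 : p * σ e' * (e' * p) = e' * p * (p * σ e') := by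
      calc p * σ e' * (e' * p) = p * (σ e' * e') * p := by noncomm_ring
        _ = p * e' * (σ e' * p) := by rw [← heσe]; noncomm_ring
        _ = e' * p * (p * σ e') := by rw [hpe, hpσe]
    rw [mul_sub, sub_mul, h5, mul_assoc p, ← hpσe]
  · have h5 : p * σ e' - (p - e' * p) = p * σ (e' - b) + (e' - b) * p := by
      rw [map_sub, hσb, mul_sub, mul_sub, hp, hpb, sub_mul, hbp]
      abel
    rw [h5]
    exact add_mem (Ideal.mul_mem_left _ _ (hσ.mem_jacobson heb))
      (Ideal.mul_mem_right _ _ heb)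

end Lifting
end HermCat

namespace HermCat

/-! ### Newton iteration for idempotents -/

section Newton

open Polynomial

/-- The Newton iteration `P ↦ 3P² - 2P³` for the equation `P² = P`, started at `X`. -/
noncomputable def newtonIdem : ℕ → ℤ[X]
  | 0 => X
  | k + 1 => 3 * newtonIdem k ^ 2 - 2 * newtonIdem k ^ 3

theorem newtonIdem_dvd (k : ℕ) :
    (X * X - X : ℤ[X]) ^ (k + 1) ∣ newtonIdem k * newtonIdem k - newtonIdem k := by
  induction k with
  | zero => simp [newtonIdem]
  | succ k ih =>
    -- Convergence is quadratic: the defect P² - P is squared at each step. Only one more factor per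
    -- step is needed.
    have h : newtonIdem (k + 1) * newtonIdem (k + 1) - newtonIdem (k + 1)
        = (newtonIdem k * newtonIdem k - newtonIdem k) ^ 2
          * (4 * (newtonIdem k * newtonIdem k - newtonIdem k) - 3) := by
      rw [newtonIdem]; ring
    rw [h]
    refine Dvd.dvd.mul_right ((pow_dvd_pow _ ?_).trans ((pow_mul _ _ 2).dvd.trans
      (pow_dvd_pow_of_dvd ih 2))) _
    omega

theorem newtonIdem_succ_dvd (k : ℕ) :
    (X * X - X : ℤ[X]) ^ (k + 1) ∣ newtonIdem (k + 1) - newtonIdem k := by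
  refine (newtonIdem_dvd k).trans ⟨-(2 * newtonIdem k - 1), ?_⟩
  rw [newtonIdem]
  ring

theorem newtonIdem_le_dvd (m k : ℕ) (h : m ≤ k) :
    (X * X - X : ℤ[X]) ^ (m + 1) ∣ newtonIdem k - newtonIdem m := by
  induction k, h using Nat.le_induction with
  | base => simp
  | succ k hk ih =>
    rw [← sub_add_sub_cancel (newtonIdem (k + 1)) (newtonIdem k)]
    exact dvd_add ((pow_dvd_pow _ (Nat.add_le_add_right hk 1)).trans (newtonIdem_succ_dvd k)) ih

variable {S : Type*} [Ring S]

theorem mul_aeval_comm {c f : S} (h : c * f = f * c) (P : ℤ[X]) :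
    c * (aeval f P : S) = (aeval f P : S) * c := by
  have h1 : Commute c f := h
  rw [aeval_eq_sum_range, Finset.mul_sum, Finset.sum_mul]
  refine Finset.sum_congr rfl fun i _ => ?_
  rw [mul_smul_comm, smul_mul_assoc, (h1.pow_right i).eq]

theorem aeval_eq_of_dvd {f : S} {P : ℤ[X]} {n : ℕ} (h : (X * X - X : ℤ[X]) ^ n ∣ P) :
    ∃ w, aeval f P = w * (f * f - f) ^ n := by
  obtain ⟨w, rfl⟩ := h
  refine ⟨aeval f w, ?_⟩
  rw [mul_comm, map_mul, map_pow, map_sub, map_mul, aeval_X]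

theorem liftsIdempotents_of_isNilpotent (h : ∀ t ∈ Ring.jacobson S, IsNilpotent t) :
    LiftsIdempotents S := by
  intro f hf
  obtain ⟨n, hn⟩ := h _ hf
  refine ⟨aeval f (newtonIdem n), ?_, ?_, fun c hc => mul_aeval_comm hc _⟩
  · obtain ⟨w, hw⟩ := aeval_eq_of_dvd (f := f) (newtonIdem_dvd n)
    rw [pow_succ, hn, zero_mul, mul_zero, map_sub, map_mul] at hw
    exact sub_eq_zero.mp hw
  · obtain ⟨w, hw⟩ := aeval_eq_of_dvd (f := f) (newtonIdem_le_dvd 0 n n.zero_le)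
    rw [map_sub, zero_add, pow_one, newtonIdem, aeval_X] at hw
    rw [hw]
    exact Ideal.mul_mem_left _ _ hf

end Newton

/-! ### Finite algebras over complete semilocal rings -/

section Complete

/-- A surjection g from Kⁿ lifts the differences f (k + 1) - f k to vectors with entries in I ^ k;
the series of lifts converges coordinatewise and its image, shifted by f 0, is the limit. -/
theorem isPrecomplete_of_finite {K : Type*} [CommRing K] (I : Ideal K) [IsPrecomplete I K]
    (M : Type*) [AddCommGroup M] [Module K M] [Module.Finite K M] : IsPrecomplete I M := by
  refine ⟨fun f hf => ?_⟩
  obtain ⟨n, g, hg⟩ := Module.Finite.exists_fin' K M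
  have hstep : ∀ k, ∃ u : Fin n → K, (∀ i, u i ∈ I ^ k) ∧ g u = f (k + 1) - f k := by
    intro k
    have h1 := (SModEq.sub_mem.mp (hf (Nat.le_succ k)).symm)
    rw [← LinearMap.range_eq_top.mpr hg, LinearMap.range_eq_map, ← Submodule.map_smul''] at h1
    obtain ⟨u, hu, hgu⟩ := h1
    refine ⟨u, fun i => ?_, hgu⟩
    refine Submodule.smul_induction_on hu (fun r hr v _ => ?_) fun x y hx hy => ?_
    · exact Ideal.mul_mem_right _ _ hr
    · exact add_mem hx hy
  choose u hu hgu using hstep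
  have hlim : ∀ i, ∃ c, ∀ N, (∑ k ∈ Finset.range N, u k i) - c ∈ I ^ N := by
    intro i
    obtain ⟨c, hc⟩ := IsPrecomplete.prec (I := I) (M := K) inferInstance
      (f := fun N => ∑ k ∈ Finset.range N, u k i) (by
        intro m n hmn
        rw [SModEq.comm, SModEq.sub_mem, ← Finset.sum_Ico_eq_sub _ hmn, smul_eq_mul, Ideal.mul_top]
        refine sum_mem fun k hk => ?_
        exact Ideal.pow_le_pow_right (Finset.mem_Ico.mp hk).1 (hu k i))
    refine ⟨c, fun N => ?_⟩
    have := SModEq.sub_mem.mp (hc N)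
    rwa [smul_eq_mul, Ideal.mul_top] at this
  choose c hc using hlim
  refine ⟨f 0 + g c, fun N => ?_⟩
  have h1 : f N - (f 0 + g c) = g (∑ k ∈ Finset.range N, u k - c) := by
    rw [map_sub, map_sum, Finset.sum_congr rfl fun k _ => hgu k, Finset.sum_range_sub]
    abel
  rw [SModEq.sub_mem, h1, LinearMap.pi_apply_eq_sum_univ g]
  refine sum_mem fun i _ => Submodule.smul_mem_smul ?_ trivial
  simpa using hc i N

variable {K : Type*} [CommRing K] {S : Type*} [Ring S] [Algebra K S]

theorem mul_mem_smul_top {I : Ideal K} (a : S) {x : S} (hx : x ∈ (I • ⊤ : Submodule K S)) :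
    a * x ∈ (I • ⊤ : Submodule K S) := by
  refine Submodule.smul_induction_on hx (fun r hr v _ => ?_) fun x y hx hy => ?_
  · rw [mul_smul_comm]; exact Submodule.smul_mem_smul hr trivial
  · rw [mul_add]; exact add_mem hx hy

theorem mem_smul_top_mul {I : Ideal K} (a : S) {x : S} (hx : x ∈ (I • ⊤ : Submodule K S)) :
    x * a ∈ (I • ⊤ : Submodule K S) := by
  refine Submodule.smul_induction_on hx (fun r hr v _ => ?_) fun x y hx hy => ?_
  · rw [smul_mul_assoc]; exact Submodule.smul_mem_smul hr trivial
  · rw [add_mul]; exact add_mem hx hy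

variable (S) in
/-- The two-sided ideal generated by an ideal of the base ring. -/
def extend (I : Ideal K) : Ideal S where
  carrier := (I • ⊤ : Submodule K S)
  add_mem' := add_mem
  zero_mem' := zero_mem _
  smul_mem' a _ hx := mul_mem_smul_top a hx

theorem mem_extend {I : Ideal K} {x : S} : x ∈ extend S I ↔ x ∈ (I • ⊤ : Submodule K S) := Iff.rfl

instance (I : Ideal K) : (extend S I).IsTwoSided := ⟨fun a hx => mem_smul_top_mul a hx⟩

/-- Nakayama's lemma: for x in Jac(K)S, left and right multiplication by 1 - x are surjective modulo
Jac(K), hence surjective. -/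
theorem extend_jacobson_le [Module.Finite K S] : extend S (Ring.jacobson K) ≤ Ring.jacobson S := by
  have hle : Ring.jacobson K ≤ (⊥ : Ideal K).jacobson := Ideal.jacobson_bot.ge
  refine le_jacobson_of_isUnit fun x hx => ?_
  have h1 : (⊤ : Submodule K S) ≤ LinearMap.range (LinearMap.mulRight K (1 - x)) :=
    Submodule.le_of_le_smul_of_le_jacobson_bot Module.Finite.fg_top hle fun z _ => by
      have : z = z * (1 - x) + z * x := by noncomm_ring
      rw [this]
      exact Submodule.add_mem_sup ⟨z, rfl⟩ (mul_mem_smul_top z hx)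
  have h2 : (⊤ : Submodule K S) ≤ LinearMap.range (LinearMap.mulLeft K (1 - x)) :=
    Submodule.le_of_le_smul_of_le_jacobson_bot Module.Finite.fg_top hle fun z _ => by
      have : z = (1 - x) * z + x * z := by noncomm_ring
      rw [this]
      exact Submodule.add_mem_sup ⟨z, rfl⟩ (mem_smul_top_mul z hx)
  obtain ⟨b, hb⟩ := h1 (x := 1) trivial
  obtain ⟨c, hc⟩ := h2 (x := 1) trivial
  exact isUnit_of_mul_eq_one hb hc

theorem isArtinianRing_quotient_extend [Module.Finite K S] (I : Ideal K) [IsArtinianRing (K ⧸ I)] :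
    IsArtinianRing (S ⧸ extend S I) := by
  let φ : K ⧸ I →+* S ⧸ extend S I := Ideal.Quotient.lift I
    ((Ideal.Quotient.mk (extend S I)).comp (algebraMap K S)) fun a ha => by
      refine Ideal.Quotient.eq_zero_iff_mem.mpr ?_
      rw [Algebra.algebraMap_eq_smul_one, mem_extend]
      exact Submodule.smul_mem_smul ha Submodule.mem_top
  let _ : Algebra (K ⧸ I) (S ⧸ extend S I) := φ.toAlgebra' fun c x => by
    obtain ⟨c, rfl⟩ := Ideal.Quotient.mk_surjective c
    obtain ⟨x, rfl⟩ := Ideal.Quotient.mk_surjective x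
    change Ideal.Quotient.mk _ (algebraMap K S c) * _ = _ * Ideal.Quotient.mk _ (algebraMap K S c)
    rw [← map_mul, ← map_mul, Algebra.commutes]
  have : IsScalarTower K (K ⧸ I) (S ⧸ extend S I) := IsScalarTower.of_algebraMap_eq fun x => rfl
  have : Module.Finite (K ⧸ I) (S ⧸ extend S I) :=
    Module.Finite.of_restrictScalars_finite K _ _
  exact IsArtinianRing.of_finite (K ⧸ I) _

variable [Module.Finite K S]

variable (S) in
theorem isSemisimpleRing_quotient_jacobson_of_finite [IsSemisimpleRing (K ⧸ Ring.jacobson K)] :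
    IsSemisimpleRing (S ⧸ Ring.jacobson S) := by
  have := isArtinianRing_quotient_extend (S := S) (Ring.jacobson K)
  have : IsArtinianRing (S ⧸ Ring.jacobson S) :=
    (Ideal.Quotient.factor_surjective (extend_jacobson_le (K := K) (S := S))).isArtinianRing
  exact IsArtinianRing.isSemisimpleRing_iff_jacobson.mpr (Ring.jacobson_quotient_jacobson S)

/-- The quotient S / Jac(K)S is artinian, so its radical is nilpotent. This links the radical of S
to the Jac(K)-adic topology. -/
theorem exists_pow_mem_extend [IsSemisimpleRing (K ⧸ Ring.jacobson K)] {t : S}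
    (ht : t ∈ Ring.jacobson S) : ∃ n, t ^ n ∈ extend S (Ring.jacobson K) := by
  have := isArtinianRing_quotient_extend (S := S) (Ring.jacobson K)
  obtain ⟨n, hn⟩ := IsSemiprimaryRing.isNilpotent (R := S ⧸ extend S (Ring.jacobson K))
  refine ⟨n, Ideal.Quotient.eq_zero_iff_mem.mp ?_⟩
  rw [map_pow]
  have h1 := Ideal.pow_mem_pow (Ideal.mem_comap.mp
    (Ring.le_comap_jacobson (Ideal.Quotient.mk (extend S (Ring.jacobson K))) ht)) n
  rw [hn] at h1
  exact h1

variable (S) in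
theorem liftsIdempotents_of_finite [IsNoetherianRing K] [IsSemisimpleRing (K ⧸ Ring.jacobson K)]
    [IsAdicComplete (Ring.jacobson K) K] : LiftsIdempotents S := by
  intro f hf
  let I := Ring.jacobson K
  have := isPrecomplete_of_finite I S
  have hH : IsHausdorff I S := IsHausdorff.of_le_jacobson I S Ideal.jacobson_bot.ge
  obtain ⟨n, hn⟩ := exists_pow_mem_extend (K := K) hf
  have hpow : ∀ k, (f * f - f) ^ (n * k) ∈ (I ^ k • ⊤ : Submodule K S) := by
    intro k
    induction k with
    | zero => simp
    | succ k ih =>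
      rw [mul_add, mul_one, pow_add (f * f - f)]
      have hn' : (f * f - f) ^ n ∈ (I • ⊤ : Submodule K S) := hn
      refine Submodule.smul_induction_on (p := fun z => (f * f - f) ^ (n * k) * z ∈ (I ^ (k + 1) • ⊤ : Submodule K S))
        hn' (fun r hr v _ => ?_) fun x y hx hy => ?_
      · rw [mul_smul_comm, pow_succ', Submodule.mul_smul]
        exact Submodule.smul_mem_smul hr (mem_smul_top_mul v ih)
      · rw [mul_add]; exact add_mem hx hy
  -- As (f² - f)ⁿ lies in IS, taking every n-th Newton iterate makes the k-th defect lie in I ^ k S,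
  -- so the iterates form a Cauchy sequence. Its limit is idempotent and keeps the commutation
  -- properties because S is separated.
  let h : ℕ → S := fun k => Polynomial.aeval f (newtonIdem (n * k))
  have hmem : ∀ k (P : Polynomial ℤ), (.X * .X - .X) ^ (n * k + 1) ∣ P →
      Polynomial.aeval f P ∈ (I ^ k • ⊤ : Submodule K S) := by
    intro k P hP
    obtain ⟨w, hw⟩ := aeval_eq_of_dvd (f := f) ((pow_dvd_pow _ (Nat.le_succ _)).trans hP)
    rw [hw]
    exact mul_mem_smul_top w (hpow k)
  have hcauchy : ∀ {k l}, k ≤ l → h k ≡ h l [SMOD I ^ k • (⊤ : Submodule K S)] := by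
    intro k l hkl
    rw [SModEq.comm, SModEq.sub_mem, ← map_sub]
    exact hmem k _ (newtonIdem_le_dvd _ _ (Nat.mul_le_mul_left n hkl))
  obtain ⟨e, he⟩ := IsPrecomplete.prec this hcauchy
  have he' : ∀ k, h k - e ∈ (I ^ k • ⊤ : Submodule K S) := fun k => SModEq.sub_mem.mp (he k)
  have hzero : ∀ x, (∀ k, x ∈ (I ^ k • ⊤ : Submodule K S)) → x = 0 := fun x hx =>
    hH.haus x fun k => SModEq.zero.mpr (hx k)
  refine ⟨e, sub_eq_zero.mp (hzero _ fun k => ?_), ?_, fun c hc => ?_⟩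
  · have h1 : h k * h k - h k ∈ (I ^ k • ⊤ : Submodule K S) := by
      rw [← map_mul, ← map_sub]
      exact hmem k _ (newtonIdem_dvd _)
    have h2 : e * e - e = (h k * h k - h k) - (h k - e) * h k - e * (h k - e) + (h k - e) := by
      noncomm_ring
    rw [h2]
    exact add_mem (sub_mem (sub_mem h1 (mem_smul_top_mul _ (he' k))) (mul_mem_smul_top _ (he' k)))
      (he' k)
  · have h1 : h 1 - f ∈ Ring.jacobson S := by
      obtain ⟨w, hw⟩ := aeval_eq_of_dvd (f := f) (newtonIdem_le_dvd 0 (n * 1) (Nat.zero_le _))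
      rw [map_sub, zero_add, pow_one, newtonIdem, Polynomial.aeval_X] at hw
      rw [hw]
      exact Ideal.mul_mem_left _ _ hf
    have h2 : h 1 - e ∈ Ring.jacobson S := by
      have := he' 1
      rw [pow_one] at this
      exact extend_jacobson_le this
    rw [← sub_sub_sub_cancel_left f e (h 1)]
    exact sub_mem h1 h2
  · refine sub_eq_zero.mp (hzero _ fun k => ?_)
    have h1 : c * h k = h k * c := mul_aeval_comm hc _
    have h2 : c * e - e * c = (h k - e) * c - c * (h k - e) := by
      rw [sub_mul, mul_sub, h1]; abel
    rw [h2]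
    exact sub_mem (mem_smul_top_mul _ (he' k)) (mul_mem_smul_top _ (he' k))

end Complete

end HermCat

namespace HermCat

/-! ### Group inverses in semiprimary rings -/

section GroupInverse

variable {E : Type*} [Ring E]

/-- `y` is a group inverse of `b`. -/
structure IsGroupInverse (b y : E) : Prop where
  comm : b * y = y * b
  mul_mul : b * y * b = b
  inv_mul_mul : y * b * y = y

theorem IsGroupInverse.pow {b y : E} (h : IsGroupInverse b y) (n : ℕ) :
    IsGroupInverse (b ^ n) (y ^ n) := by
  have hc : Commute b y := h.comm
  refine ⟨hc.pow_pow n n, ?_, ?_⟩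
  · rw [← hc.mul_pow, ← Commute.mul_pow ((Commute.refl b).mul_left hc.symm), h.mul_mul]
  · rw [← hc.symm.mul_pow, ← Commute.mul_pow ((Commute.refl y).mul_left hc), h.inv_mul_mul]

/-- The hypotheses say that right multiplication by b is bijective on the left ideal Eb; the group
inverse is z²b. -/
theorem exists_isGroupInverse {b z : E} (hz : b = z * (b * b))
    (hb : ∀ x, x * (b * b) = 0 → x * b = 0) : ∃ y, IsGroupInverse b y := by
  have h1 : b * z * b = b := by
    have := hb (b * z - 1) (by rw [sub_mul, mul_assoc, ← hz, one_mul, sub_self])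
    rwa [sub_mul, one_mul, sub_eq_zero] at this
  have h2 : b * (z * z) * (b * b) = b := by
    rw [← mul_assoc b z z, mul_assoc (b * z), ← hz, h1]
  have h3 : z * z * b * (b * b) = b := by
    rw [← mul_assoc, mul_assoc (z * z), mul_assoc z z, ← hz, mul_assoc, ← hz]
  have h4 : b * (z * z) * b = z * z * b * b := by
    have := hb (b * (z * z) - z * z * b) (by rw [sub_mul, h2, h3, sub_self])
    rwa [sub_mul, sub_eq_zero] at this
  refine ⟨z * z * b, ?_, ?_, ?_⟩
  · rw [← h4, mul_assoc b]
  · calc b * (z * z * b) * b = b * (z * z) * b * b := by simp only [mul_assoc]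
      _ = z * z * b * (b * b) := by rw [h4]; simp only [mul_assoc]
      _ = b := h3
  · calc z * z * b * b * (z * z * b) = z * z * b * (b * (z * z) * b) := by simp only [mul_assoc]
      _ = z * z * b * (z * z * b * b) := by rw [h4]
      _ = z * z * (b * (z * z) * (b * b)) := by simp only [mul_assoc]
      _ = z * z * b := by rw [h2]

theorem exists_pow_isGroupInverse_of_isSemisimpleRing [IsSemisimpleRing E] (a : E) :
    ∃ n y, 0 < n ∧ IsGroupInverse (a ^ n) y := by
  -- Fitting's lemma for right multiplication by a: for large n the ring is the direct sum of the
  -- kernel and the image of right multiplication by aⁿ.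
  obtain ⟨n, hn, hn0⟩ := ((LinearMap.eventually_isCompl_ker_pow_range_pow
    (LinearMap.toSpanSingleton E E a)).and (Filter.eventually_gt_atTop 0)).exists
  have hpow : ∀ n x, (LinearMap.toSpanSingleton E E a ^ n) x = x * a ^ n := by
    intro n
    induction n with
    | zero => simp
    | succ n ih =>
      intro x
      rw [pow_succ', Module.End.mul_apply, ih, LinearMap.toSpanSingleton_apply, smul_eq_mul,
        mul_assoc, pow_succ]
  refine ⟨n, ?_⟩
  obtain ⟨k, hk, _, ⟨z, rfl⟩, h⟩ := Submodule.mem_sup.mp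
    (hn.sup_eq_top.ge (Submodule.mem_top (x := (1 : E))))
  rw [LinearMap.mem_ker, hpow] at hk
  rw [hpow] at h
  suffices ∃ y, IsGroupInverse (a ^ n) y from this.imp fun _ h => ⟨hn0, h⟩
  refine exists_isGroupInverse (z := z) ?_ fun x hx => ?_
  · have := congrArg (· * a ^ n) h
    simp only [add_mul, hk, zero_add, one_mul] at this
    rw [← mul_assoc, this]
  · have h1 : x * a ^ n ∈ LinearMap.ker (LinearMap.toSpanSingleton E E a ^ n) := by
      rw [LinearMap.mem_ker, hpow, mul_assoc, hx]
    exact (Submodule.disjoint_def.mp hn.disjoint) _ h1 ⟨x, hpow n x⟩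

theorem exists_pow_isGroupInverse [IsSemiprimaryRing E] (a : E) :
    ∃ n y, 0 < n ∧ IsGroupInverse (a ^ n) y := by
  obtain ⟨n, y, hn0, h⟩ := exists_pow_isGroupInverse_of_isSemisimpleRing
    (Ideal.Quotient.mk (Ring.jacobson E) a)
  obtain ⟨y, rfl⟩ := Ideal.Quotient.mk_surjective y
  rw [← map_pow] at h
  obtain ⟨b, hb⟩ : ∃ b, b = a ^ n := ⟨_, rfl⟩
  rw [← hb] at h
  let J := Ring.jacobson E
  have h1 : b - b * b * y ∈ J := by
    rw [← Ideal.Quotient.eq, map_mul, map_mul, mul_assoc, h.comm, ← mul_assoc, h.mul_mul]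
  have h2 : ∀ j, b - y ^ j * b ^ (j + 1) ∈ J := by
    intro j
    rw [← Ideal.Quotient.eq, map_mul, map_pow, map_pow]
    induction j with
    | zero => simp
    | succ j ih =>
      rw [pow_succ' _ (j + 1), pow_succ, mul_assoc, ← mul_assoc (Ideal.Quotient.mk J y)]
      have h3 := h.mul_mul
      rw [h.comm, mul_assoc] at h3
      rw [pow_succ' _ j, ← mul_assoc _ _ (_ ^ j), mul_assoc (Ideal.Quotient.mk J y), h3, ← pow_succ']
      exact ih
  -- Induction along the radical filtration: modulo J ^ i, right multiplication by b is injective on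
  -- E b ^ i and E b ^ i = E b ^ (i + 1). The nilpotency of J turns this into statements in E.
  have key : ∀ i, (∀ x, x * b ^ (i + 1) ∈ J ^ i → x * b ^ i ∈ J ^ i) ∧
      ∃ z, b ^ i - z * b ^ (i + 1) ∈ J ^ i := by
    intro i
    induction i with
    | zero => simp [Submodule.pow_zero, Ideal.one_eq_top]
    | succ i ih =>
      obtain ⟨hk, z, hz⟩ := ih
      refine ⟨fun x hx => ?_, z + (b ^ i - z * b ^ (i + 1)) * y ^ (i + 1), ?_⟩
      · have h3 : x * b ^ i ∈ J ^ i := by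
          refine hk x ?_
          rw [pow_succ', ← mul_assoc]
          refine hk _ ?_
          rw [mul_assoc, ← pow_succ']
          exact Ideal.pow_le_pow_right (Nat.le_succ i) hx
        have h4 : x * b ^ (i + 1) = x * b ^ i * (b - b * b * y) + x * b ^ (i + 1 + 1) * y := by
          rw [pow_succ b (i + 1), pow_succ b i]
          noncomm_ring
        rw [h4]
        refine add_mem ?_ (Ideal.mul_mem_right _ _ hx)
        exact Ideal.mul_mem_mul h3 h1
      · have h4 : b ^ (i + 1) - (z + (b ^ i - z * b ^ (i + 1)) * y ^ (i + 1)) * b ^ (i + 1 + 1)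
            = (b ^ i - z * b ^ (i + 1)) * (b - y ^ (i + 1) * b ^ (i + 1 + 1)) := by
          rw [mul_sub, sub_mul _ _ b, ← pow_succ, mul_assoc z, ← pow_succ, add_mul, mul_assoc _ _ (b ^ _)]
          abel
        rw [h4]
        exact Ideal.mul_mem_mul hz (h2 _)
  obtain ⟨k, hk⟩ := IsSemiprimaryRing.isNilpotent (R := E)
  -- A positive k keeps the exponent n * k positive, so that this power of a radical element still
  -- lies in the radical.
  obtain ⟨k, hk0, hk⟩ : ∃ k, 0 < k ∧ J ^ k = 0 :=
    ⟨k + 1, k.succ_pos, by rw [Submodule.pow_succ, hk, Submodule.zero_eq_bot, Ideal.bot_mul]⟩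
  obtain ⟨h3, z, hz⟩ := key k
  simp only [hk, Submodule.zero_eq_bot, Submodule.mem_bot] at h3 hz
  rw [sub_eq_zero] at hz
  suffices ∃ y, IsGroupInverse (a ^ (n * k)) y from
    ⟨n * k, this.imp fun _ h => ⟨Nat.mul_pos hn0 hk0, h⟩⟩
  rw [pow_mul, ← hb]
  have h4 : ∀ j, b ^ k = z ^ j * b ^ (k + j) := by
    intro j
    induction j with
    | zero => simp
    | succ j ih =>
      rw [ih]
      conv_lhs => rw [pow_add, hz, mul_assoc z, ← pow_add, ← mul_assoc, ← pow_succ]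
      congr 2
      omega
  have h5 : ∀ j x, x * b ^ (k + j) = 0 → x * b ^ k = 0 := by
    intro j
    induction j with
    | zero => simp
    | succ j ih =>
      intro x hx
      refine h3 x ?_
      rw [pow_succ', ← mul_assoc]
      refine ih _ ?_
      rw [mul_assoc, ← pow_succ']
      exact hx
  refine exists_isGroupInverse (z := z ^ k) ?_ fun x hx => h5 k x ?_
  · rw [← pow_add]; exact h4 k
  · rw [pow_add]; exact hx

end GroupInverse

/-! ### Endomorphism rings of twisted double arrows -/

section Endomorphisms

variable {C : Type u} [Category.{v} C] [HermitianStructure C]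

/-- Group inverses of morphisms that are intertwined by a sesquilinear form are intertwined. -/
theorem IsGroupInverse.intertwine [Preadditive C] {X Y : C} {f : X ⟶ dual Y} {b y : End X}
    {c z : End Y} (hb : IsGroupInverse b y) (hc : IsGroupInverse c z)
    (h : b ≫ f = f ≫ dualMap c) : y ≫ f = f ≫ dualMap z := by
  have b1 : b ≫ y = y ≫ b := hb.comm.symm
  have b2 : b ≫ y ≫ b = b := hb.mul_mul
  have b3 : y ≫ b ≫ y = y := hb.inv_mul_mul
  have c1 : dualMap c ≫ dualMap z = dualMap z ≫ dualMap c := by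
    rw [← dualMap_comp, ← dualMap_comp]
    exact congrArg dualMap hc.comm
  have c2 : dualMap c ≫ dualMap c ≫ dualMap z = dualMap c := by
    rw [c1, ← dualMap_comp, ← dualMap_comp]
    exact congrArg dualMap ((Category.assoc _ _ _).trans hc.mul_mul)
  have c3 : dualMap c ≫ dualMap z ≫ dualMap z = dualMap z := by
    rw [← Category.assoc, c1, ← dualMap_comp, ← dualMap_comp]
    exact congrArg dualMap hc.inv_mul_mul
  -- Expanding y = y²b on the left, or z = z²c on the right, and moving factors across f turns both
  -- sides into y ≫ f ≫ c^* ≫ z^*.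
  have h1 : y ≫ f = y ≫ f ≫ dualMap c ≫ dualMap z := by
    calc y ≫ f = y ≫ y ≫ b ≫ f := by
          rw [← Category.assoc y b f, ← b1, ← Category.assoc y, b3]
      _ = y ≫ y ≫ (f ≫ dualMap c) ≫ dualMap c ≫ dualMap z := by rw [h, Category.assoc, c2]
      _ = (y ≫ y ≫ b) ≫ f ≫ dualMap c ≫ dualMap z := by rw [← h]; simp only [Category.assoc]
      _ = y ≫ f ≫ dualMap c ≫ dualMap z := by rw [← b1, b3]
  have h2 : f ≫ dualMap z = y ≫ b ≫ f ≫ dualMap z := by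
    calc f ≫ dualMap z = (f ≫ dualMap c) ≫ dualMap z ≫ dualMap z := by rw [Category.assoc, c3]
      _ = (y ≫ b ≫ b) ≫ f ≫ dualMap z ≫ dualMap z := by
          rw [← Category.assoc y, ← b1, Category.assoc b y b, b2, ← h, Category.assoc]
      _ = y ≫ b ≫ (f ≫ dualMap c) ≫ dualMap z ≫ dualMap z := by
          rw [← h]; simp only [Category.assoc]
      _ = y ≫ b ≫ f ≫ dualMap z := by rw [Category.assoc f, c3]
  rw [h1, h2, ← reassoc_of% h]

variable [Preadditive C] [HasZeroObject C] [HasBinaryBiproducts C]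

namespace TwistedArrow

variable {Z : TwistedArrow C}

theorem sub_φ {Z W : TwistedArrow C} (a b : Z ⟶ W) : (a - b).φ = a.φ - b.φ := by
  rw [sub_eq_add_neg, sub_eq_add_neg]; rfl

theorem sub_ψ {Z W : TwistedArrow C} (a b : Z ⟶ W) : (a - b).ψ = a.ψ - b.ψ := by
  rw [sub_eq_add_neg, sub_eq_add_neg]; rfl

/-- The first component of an endomorphism. -/
def endφ (a : End Z) : End Z.src := Hom.φ a

/-- The second component of an endomorphism. -/
def endψ (a : End Z) : End Z.tgt := Hom.ψ a

theorem end_ext {a b : End Z} (h1 : endφ a = endφ b) (h2 : endψ a = endψ b) : a = b :=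
  Hom.ext h1 h2

theorem endφ_mul (a b : End Z) : endφ (a * b) = endφ a * endφ b := rfl
theorem endψ_mul (a b : End Z) : endψ (a * b) = endψ b * endψ a := rfl
theorem endφ_one : endφ (1 : End Z) = 1 := rfl
theorem endψ_one : endψ (1 : End Z) = 1 := rfl
theorem endφ_sub (a b : End Z) : endφ (a - b) = endφ a - endφ b := sub_φ a b
theorem endψ_sub (a b : End Z) : endψ (a - b) = endψ a - endψ b := sub_ψ a b

theorem endφ_pow (a : End Z) (n : ℕ) : endφ (a ^ n) = endφ a ^ n := by
  induction n with
  | zero => rfl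
  | succ n ih => rw [pow_succ, pow_succ, endφ_mul, ih]

theorem endψ_pow (a : End Z) (n : ℕ) : endψ (a ^ n) = endψ a ^ n := by
  induction n with
  | zero => rfl
  | succ n ih => rw [pow_succ, pow_succ', endψ_mul, ih]

/-- Inverses of the components automatically commute with both structure maps, so units of `End Z`
are detected in End(src) × End(tgt)ᵒᵖ. -/
theorem isUnit_of_components {a : End Z} (h1 : IsUnit (endφ a)) (h2 : IsUnit (endψ a)) :
    IsUnit a := by
  obtain ⟨u, hu⟩ := h1
  obtain ⟨w, hw⟩ := h2
  have u1 : (u⁻¹ : (End Z.src)ˣ).val ≫ Hom.φ a = 𝟙 Z.src := by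
    change endφ a * (u⁻¹ : (End Z.src)ˣ).val = 1
    rw [← hu, u.mul_inv]
  have u2 : Hom.φ a ≫ (u⁻¹ : (End Z.src)ˣ).val = 𝟙 Z.src := by
    change (u⁻¹ : (End Z.src)ˣ).val * endφ a = 1
    rw [← hu, u.inv_mul]
  have w1 : (w⁻¹ : (End Z.tgt)ˣ).val ≫ Hom.ψ a = 𝟙 Z.tgt := by
    change endψ a * (w⁻¹ : (End Z.tgt)ˣ).val = 1
    rw [← hw, w.mul_inv]
  have w2 : Hom.ψ a ≫ (w⁻¹ : (End Z.tgt)ˣ).val = 𝟙 Z.tgt := by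
    change (w⁻¹ : (End Z.tgt)ˣ).val * endψ a = 1
    rw [← hw, w.inv_mul]
  have comm : ∀ f : Z.src ⟶ dual Z.tgt, Hom.φ a ≫ f = f ≫ dualMap (Hom.ψ a) →
      (u⁻¹ : (End Z.src)ˣ).val ≫ f = f ≫ dualMap (w⁻¹ : (End Z.tgt)ˣ).val := by
    intro f hf
    calc (u⁻¹ : (End Z.src)ˣ).val ≫ f
        = (u⁻¹ : (End Z.src)ˣ).val ≫ f ≫ dualMap ((w⁻¹ : (End Z.tgt)ˣ).val ≫ Hom.ψ a) := by
          rw [w1, dualMap_id, Category.comp_id]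
      _ = ((u⁻¹ : (End Z.src)ˣ).val ≫ Hom.φ a) ≫ f ≫ dualMap (w⁻¹ : (End Z.tgt)ˣ).val := by
          rw [dualMap_comp, ← reassoc_of% hf, Category.assoc]
      _ = _ := by rw [u1, Category.id_comp]
  let b : End Z := Hom.mk (Z := Z) (W := Z) (u⁻¹ : (End Z.src)ˣ).val (w⁻¹ : (End Z.tgt)ˣ).val
    (comm _ a.comm_f) (comm _ a.comm_g)
  exact isUnit_of_mul_eq_one (b := b) (c := b) (Hom.ext u2 w1) (Hom.ext u1 w2)

section Semiprimary

variable [IsSemiprimaryRing (End Z.src)] [IsSemiprimaryRing (End Z.tgt)]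

variable (Z) in
theorem isSemisimpleRing_quotient_jacobson : IsSemisimpleRing (End Z ⧸ Ring.jacobson (End Z)) := by
  let π₁ := Ideal.Quotient.mk (Ring.jacobson (End Z.src))
  let π₂ := Ideal.Quotient.mk (Ring.jacobson (End Z.tgt))
  refine isSemisimpleRing_quotient_jacobson_of_rank
    -- The rank records the left annihilators of the two components in the artinian quotients;
    -- ascending chains of pairs of left ideals stabilise there.
    (P := Ideal (End Z.src ⧸ Ring.jacobson (End Z.src)) ×
      Ideal (End Z.tgt ⧸ Ring.jacobson (End Z.tgt)))
    (fun a => (LinearMap.ker (LinearMap.toSpanSingleton _ _ (π₁ (endφ a))),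
      LinearMap.ker (LinearMap.toSpanSingleton _ _ (π₂ (endψ a)))))
    (fun a b => Prod.mk_le_mk.mpr ⟨?_, ?_⟩) fun a b h => ?_
  · simp only [endφ_sub, endφ_mul, map_sub, map_mul]
    exact ker_toSpanSingleton_le _ _
  · simp only [endψ_sub, endψ_mul, map_sub, map_mul, ← mul_assoc]
    exact ker_toSpanSingleton_le _ _
  · simp only [endφ_sub, endφ_mul, map_sub, map_mul, endψ_sub, endψ_mul, Prod.mk.injEq] at h
    refine isUnit_of_components (isUnit_of_isUnit_quotient_jacobson ?_)
      (isUnit_of_isUnit_quotient_jacobson ?_)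
    · rw [endφ_sub, endφ_mul, endφ_one, map_sub, map_mul, map_one]
      exact isUnit_one_sub_of_ker_eq _ _ h.1
    · rw [endψ_sub, endψ_mul, endψ_one, map_sub, map_mul, map_one]
      -- The second component reverses products, so the criterion applies to 1 - ba in place of 1 -
      -- ab.
      refine isUnit_one_sub_mul_comm (isUnit_one_sub_of_ker_eq _ _ ?_)
      rw [mul_assoc]
      exact h.2

/-- Some power b of t has a group inverse w, first in each component and then in `End Z` by
intertwining. The idempotent bw lies in the radical, so it is zero and b = bwb = 0. -/
theorem isNilpotent_of_mem_jacobson {t : End Z} (ht : t ∈ Ring.jacobson (End Z)) :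
    IsNilpotent t := by
  obtain ⟨m, y, hm, hy⟩ := exists_pow_isGroupInverse (endφ t)
  obtain ⟨n, z, hn, hz⟩ := exists_pow_isGroupInverse (endψ t)
  -- The exponents m and n of the two components are brought to the common value m * n.
  have hy' := hy.pow n
  have hz' := hz.pow m
  rw [← pow_mul] at hy' hz'
  rw [mul_comm n m, ← endψ_pow] at hz'
  rw [← endφ_pow] at hy'
  let b : End Z := t ^ (m * n)
  let w : End Z := Hom.mk (Z := Z) (W := Z) (y ^ n : End Z.src) (z ^ m : End Z.tgt)
    (hy'.intertwine hz' (Hom.comm_f b)) (hy'.intertwine hz' (Hom.comm_g b))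
  have h1 : b * w * b = b := end_ext hy'.mul_mul ((mul_assoc _ _ _).symm.trans hz'.mul_mul)
  have h2 : b * w * (b * w) = b * w := by rw [← mul_assoc, h1]
  have h3 : b ∈ Ring.jacobson (End Z) := Ideal.pow_mem_of_mem _ ht _ (Nat.mul_pos hm hn)
  refine ⟨m * n, ?_⟩
  have h4 := eq_zero_of_isIdempotentElem_of_mem_jacobson h2 (Ideal.mul_mem_right _ _ h3)
  rw [h4, zero_mul] at h1
  exact h1.symm

end Semiprimary

end TwistedArrow

end Endomorphisms

end HermCat

namespace HermCat

section

variable {C : Type u} [Category.{v} C] [Preadditive C] [HasZeroObject C]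
  [HasBinaryBiproducts C] [HermitianStructure C]

namespace TwistedArrow

/-! ### Endomorphism rings of twisted double arrows over a complete semilocal base -/

section Linear

variable {K : Type w} [CommRing K] [Linear K C]

/-- The action of the base ring on a twisted double arrow. -/
def scalar (hK : IsLinearHermitian K C) (Z : TwistedArrow C) : K →+* End Z where
  toFun k := Hom.mk (Z := Z) (W := Z) (k • 𝟙 Z.src) (k • 𝟙 Z.tgt)
    (by simp [hK _ _ k (𝟙 Z.tgt)]) (by simp [hK _ _ k (𝟙 Z.tgt)])
  map_one' := Hom.ext (one_smul _ _) (one_smul _ _)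
  map_mul' a b := Hom.ext
    (by change (a * b) • 𝟙 Z.src = (b • 𝟙 Z.src) ≫ (a • 𝟙 Z.src); simp [mul_smul])
    (by change (a * b) • 𝟙 Z.tgt = (a • 𝟙 Z.tgt) ≫ (b • 𝟙 Z.tgt); simp [mul_smul, smul_comm a b])
  map_zero' := Hom.ext (zero_smul _ _) (zero_smul _ _)
  map_add' a b := Hom.ext (add_smul _ _ _) (add_smul _ _ _)

theorem scalar_commutes (hK : IsLinearHermitian K C) (Z : TwistedArrow C) (k : K) (a : End Z) :
    scalar hK Z k * a = a * scalar hK Z k :=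
  Hom.ext (by change Hom.φ a ≫ (k • 𝟙 Z.src) = (k • 𝟙 Z.src) ≫ Hom.φ a; simp)
    (by change (k • 𝟙 Z.tgt) ≫ Hom.ψ a = Hom.ψ a ≫ (k • 𝟙 Z.tgt); simp)

/-- `End Z` embeds K-linearly in a product of two finite Hom modules; K being noetherian, it is a
finite K-algebra. -/
theorem isSemisimpleRing_and_liftsIdempotents [IsNoetherianRing K]
    (hK : IsLinearHermitian K C) (hKs : IsCompleteSemilocal K)
    (hfin : ∀ M N : C, Module.Finite K (M ⟶ N)) (Z : TwistedArrow C) :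
    IsSemisimpleRing (End Z ⧸ Ring.jacobson (End Z)) ∧ LiftsIdempotents (End Z) := by
  let _ : Algebra K (End Z) := (scalar hK Z).toAlgebra' (scalar_commutes hK Z)
  obtain ⟨h1, h2⟩ := hKs
  let g : End Z →ₗ[K] (Z.src ⟶ Z.src) × (Z.tgt ⟶ Z.tgt) :=
    { toFun := fun a => (Hom.φ a, Hom.ψ a)
      map_add' := fun _ _ => rfl
      map_smul' := fun k a => by
        rw [Algebra.smul_def]
        refine Prod.ext ?_ ?_
        · change Hom.φ a ≫ (k • 𝟙 Z.src) = k • Hom.φ a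
          simp
        · change (k • 𝟙 Z.tgt) ≫ Hom.ψ a = k • Hom.ψ a
          simp }
  have := hfin Z.src Z.src
  have := hfin Z.tgt Z.tgt
  have : Module.Finite K (End Z) := Module.Finite.of_injective g fun a b h =>
    Hom.ext (Prod.ext_iff.mp h).1 (Prod.ext_iff.mp h).2
  exact ⟨isSemisimpleRing_quotient_jacobson_of_finite (K := K) _,
    liftsIdempotents_of_finite (K := K) _⟩

end Linear

end TwistedArrow

/-! ### Hyperbolic forms and idempotents -/

namespace SesqForm

/-- An idempotent of `M` splitting the form `(M, s)` into two totally isotropic summands. -/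
structure IsHyperbolicIdem (s : SesqForm C) (e : s.obj ⟶ s.obj) : Prop where
  idem : e ≫ e = e
  comm : e ≫ s.form = s.form ≫ dualMap (𝟙 s.obj - e)

theorem dualMap_sub {X Y : C} (f g : X ⟶ Y) : dualMap (f - g) = dualMap f - dualMap g := by
  rw [sub_eq_add_neg, dualMap_add, dualMap_neg, ← sub_eq_add_neg]

/-- The idempotent is the projection onto Q along its dual, transported through the isometry. -/
theorem IsHermHyperbolic.exists_idem {s : SesqForm C} (h : s.IsHermHyperbolic) :
    ∃ e, IsHyperbolicIdem s e := by
  obtain ⟨Q, -, α, hα⟩ := h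
  have key : ∀ α : s.obj ≅ Q ⊞ dual Q,
      s.form = α.hom ≫ offDiagMat (𝟙 (dual Q)) (bidual Q) ≫ dualMap α.hom →
      ∃ e, IsHyperbolicIdem s e := by
    intro α hα
    refine ⟨α.hom ≫ biprod.fst ≫ biprod.inl ≫ α.inv, by simp, ?_⟩
    have h1 : 𝟙 s.obj - α.hom ≫ biprod.fst ≫ biprod.inl ≫ α.inv
        = α.hom ≫ biprod.snd ≫ biprod.inr ≫ α.inv := by
      rw [sub_eq_iff_eq_add', ← α.hom_inv_id, ← Preadditive.comp_add, ← Category.assoc biprod.fst,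
        ← Category.assoc biprod.snd, ← Preadditive.add_comp, biprod.total, Category.id_comp]
    have h2 : dualMap α.hom ≫ dualMap α.inv = 𝟙 _ := by
      rw [← dualMap_comp, α.inv_hom_id, dualMap_id]
    rw [h1, hα]
    simp only [dualMap_comp, Category.assoc, Iso.inv_hom_id_assoc]
    rw [reassoc_of% h2, ← Category.assoc (offDiagMat _ _), offDiagMat_inr,
      ← Category.assoc biprod.inl, inl_offDiagMat]
    simp only [Category.assoc]
  exact key α hα

/-- The form of F(M, s) is (id, id), so its hyperbolic idempotent is a pair (r₁, 1 - r₁); being an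
endomorphism of the twisted arrow is then the required relation for r₁ and s. -/
theorem IsHyperbolic.exists_idem {s : SesqForm C} (h : s.IsHyperbolic) :
    ∃ e, IsHyperbolicIdem s e := by
  obtain ⟨ρ, h1, h2⟩ := IsHermHyperbolic.exists_idem h
  let r₁ : s.obj ⟶ s.obj := ρ.φ
  let r₂ : s.obj ⟶ s.obj := ρ.ψ
  have h3 : r₁ ≫ 𝟙 s.obj = 𝟙 s.obj ≫ (𝟙 s.obj - r₂) :=
    (congrArg TwistedArrow.Hom.φ h2).trans
      (congrArg (𝟙 s.obj ≫ ·) (TwistedArrow.sub_ψ (𝟙 s.toTwisted.obj) ρ))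
  have h4 : r₂ = 𝟙 s.obj - r₁ := by
    rw [Category.comp_id, Category.id_comp] at h3
    rw [h3, sub_sub_cancel]
  exact ⟨r₁, congrArg TwistedArrow.Hom.φ h1, by rw [← h4]; exact ρ.comm_g⟩

theorem IsHyperbolicIdem.compl_comm {s : SesqForm C} {e : s.obj ⟶ s.obj}
    (h : IsHyperbolicIdem s e) : (𝟙 s.obj - e) ≫ s.form = s.form ≫ dualMap e := by
  have h1 := h.comm
  rw [dualMap_sub, Preadditive.comp_sub, dualMap_id, Category.comp_id] at h1
  rw [Preadditive.sub_comp, Category.id_comp, h1, sub_sub_cancel]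

variable [IsIdempotentComplete C]

/-- Splitting e and 1 - e decomposes M as A ⊕ B with both summands isotropic, so s becomes an
off-diagonal matrix; such forms are hyperbolic. -/
theorem IsHyperbolicIdem.isHyperbolic {s : SesqForm C} {e : s.obj ⟶ s.obj}
    (h : IsHyperbolicIdem s e) : s.IsHyperbolic := by
  have hid : (𝟙 s.obj - e) ≫ (𝟙 s.obj - e) = 𝟙 s.obj - e := by
    simp [h.idem]
  obtain ⟨A, i, π, hi, hπ⟩ := IsIdempotentComplete.idempotents_split s.obj e h.idem
  obtain ⟨B, j, ρ, hj, hρ⟩ := IsIdempotentComplete.idempotents_split s.obj _ hid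
  have h1 : i ≫ ρ = 0 := by
    have : i ≫ ρ = i ≫ (π ≫ i) ≫ (ρ ≫ j) ≫ ρ := by
      simp only [Category.assoc, hj, Category.comp_id, reassoc_of% hi]
    rw [this, hπ, hρ, Preadditive.sub_comp, Category.id_comp, Preadditive.comp_sub,
      reassoc_of% h.idem, sub_self, comp_zero]
  have h2 : j ≫ π = 0 := by
    have : j ≫ π = j ≫ (ρ ≫ j) ≫ (π ≫ i) ≫ π := by
      simp only [Category.assoc, hi, Category.comp_id, reassoc_of% hj]
    rw [this, hπ, hρ, Preadditive.sub_comp, Category.id_comp, reassoc_of% h.idem, sub_self,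
      comp_zero]
  have h5 : biprod.lift π ρ ≫ biprod.desc i j = 𝟙 s.obj := by
    rw [biprod.lift_desc, hπ, hρ, add_sub_cancel]
  refine IsHyperbolic.of_isometric (t := offDiag A B (j ≫ s.form ≫ dualMap i)
    (i ≫ s.form ≫ dualMap j)) ⟨⟨biprod.lift π ρ, biprod.desc i j, h5,
      lift_desc_eq π ρ i j hi h1 h2 hj⟩, ?_⟩ (offDiag_isHyperbolic _ _ _ _)
  · have h3 : s.form = e ≫ s.form ≫ dualMap (𝟙 s.obj - e)
        + (𝟙 s.obj - e) ≫ s.form ≫ dualMap e := by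
      rw [← h.comm, ← h.compl_comm, reassoc_of% h.idem, reassoc_of% hid, ← Preadditive.add_comp,
        add_sub_cancel, Category.id_comp]
    have h4 : biprod.lift π ρ ≫ offDiagMat (j ≫ s.form ≫ dualMap i) (i ≫ s.form ≫ dualMap j)
        ≫ dualMap (biprod.lift π ρ) = s.form := by
      conv_rhs => rw [h3, add_comm]
      rw [← hρ, ← hπ]
      simp [offDiagMat, ← dualMap_comp]
    exact h4.symm

/-- A unimodular hermitian form that is hyperbolic as a sesquilinear form is hyperbolic. -/
theorem IsHyperbolicIdem.isHermHyperbolic {s : SesqForm C} {e : s.obj ⟶ s.obj}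
    (h : IsHyperbolicIdem s e) (hs : s.IsHermitian) (hu : s.IsUnimodular) :
    s.IsHermHyperbolic := by
  obtain ⟨A, i, π, hi, hπ⟩ := IsIdempotentComplete.idempotents_split s.obj e h.idem
  have := hu.1
  have hie : i ≫ e = i := by rw [← hπ, reassoc_of% hi]
  have heπ : e ≫ π = π := by rw [← hπ, Category.assoc, hi, Category.comp_id]
  have hinv : inv s.form ≫ e = dualMap (𝟙 s.obj - e) ≫ inv s.form := by
    rw [IsIso.inv_comp_eq, ← Category.assoc, ← h.comm, Category.assoc, IsIso.hom_inv_id,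
      Category.comp_id]
  have hω : IsIso (bidual s.obj) := by
    have h1 : IsIso (dualMap s.form) :=
      ⟨dualMap (inv s.form), by simp [← dualMap_comp], by simp [← dualMap_comp]⟩
    have h2 : IsIso (bidual s.obj ≫ dualMap s.form) := hu.2
    exact IsIso.of_isIso_comp_right _ (dualMap s.form)
  -- The image A of e serves as Q. It is reflexive as a retract of the reflexive object M, and s
  -- identifies the image of 1 - e with the dual of A.
  refine ⟨A, ⟨dualMap (dualMap i) ≫ inv (bidual s.obj) ≫ π, ?_, ?_⟩,
    isometric_hyp π (s.form ≫ dualMap i) i (dualMap π ≫ inv s.form) hi ?_ ?_ ?_ ?_ ?_⟩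
  · rw [← Category.assoc, ← bidual_naturality, Category.assoc, IsIso.hom_inv_id_assoc, hi]
  · simp only [Category.assoc]
    rw [bidual_naturality π, IsIso.inv_hom_id_assoc, ← dualMap_comp, ← dualMap_comp, hi,
      dualMap_id, dualMap_id]
  · have h1 : i ≫ s.form = i ≫ s.form ≫ dualMap (𝟙 s.obj - e) := by
      rw [← h.comm, reassoc_of% hie]
    rw [← Category.assoc, h1]
    simp only [Category.assoc]
    rw [← dualMap_comp, Preadditive.comp_sub, Category.comp_id, hie, sub_self, dualMap_zero,
      comp_zero, comp_zero]
  · have h1 : inv s.form ≫ π = dualMap (𝟙 s.obj - e) ≫ inv s.form ≫ π := by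
      rw [← reassoc_of% hinv, heπ]
    rw [Category.assoc, h1, ← Category.assoc, ← dualMap_comp, Preadditive.sub_comp, heπ,
      Category.id_comp, sub_self, dualMap_zero, zero_comp]
  · rw [Category.assoc, IsIso.inv_hom_id_assoc, ← dualMap_comp, hi, dualMap_id]
  · rw [hπ, Category.assoc, ← Category.assoc (dualMap i), ← dualMap_comp, hπ, ← Category.assoc,
      ← h.compl_comm, Category.assoc, IsIso.hom_inv_id, Category.comp_id, add_sub_cancel]
  · have h1 : s.form = bidual s.obj ≫ dualMap s.form := hs
    rw [Category.assoc, ← dualMap_comp, hπ, ← h.compl_comm, dualMap_comp, ← Category.assoc (bidual A),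
      ← bidual_naturality, Category.assoc, ← h1, reassoc_of% hπ, ← Preadditive.add_comp,
      sub_add_cancel, Category.id_comp]

end SesqForm
end
end HermCat

namespace HermCat

/-! ### Cancellation of hyperbolic summands -/

section Cancellation

variable {C : Type u} [Category.{v} C] [Preadditive C] [HasZeroObject C]
  [HasBinaryBiproducts C] [HermitianStructure C]

namespace SesqForm

/-- The endomorphism ring of the twisted double arrow attached to a sesquilinear form. -/
abbrev EndTwisted (s : SesqForm C) : Type v := End s.toTwisted.obj

/-- A pair of adjoint endomorphisms of `(M, s)`. -/
def mkEnd (s : SesqForm C) (a b : s.obj ⟶ s.obj) (h : a ≫ s.form = s.form ≫ dualMap b)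
    (h' : b ≫ s.form = s.form ≫ dualMap a) : s.EndTwisted :=
  TwistedArrow.Hom.mk (Z := s.toTwisted.obj) (W := s.toTwisted.obj) a b
    (TwistedArrow.dual_comm (Z := s.toTwisted.obj) (W := s.toTwisted.obj) b a s.form s.form h') h

namespace EndTwisted

variable {s : SesqForm C}

/-- The first component of an endomorphism. -/
def left (a : s.EndTwisted) : s.obj ⟶ s.obj := TwistedArrow.Hom.φ a

/-- The second component of an endomorphism. -/
def right (a : s.EndTwisted) : s.obj ⟶ s.obj := TwistedArrow.Hom.ψ a

theorem ext {a b : s.EndTwisted} (h1 : left a = left b) (h2 : right a = right b) : a = b :=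
  TwistedArrow.Hom.ext h1 h2

theorem left_sub (a b : s.EndTwisted) : left (a - b) = left a - left b := TwistedArrow.sub_φ a b
theorem right_sub (a b : s.EndTwisted) : right (a - b) = right a - right b :=
  TwistedArrow.sub_ψ a b

theorem left_comm (a : s.EndTwisted) : left a ≫ s.form = s.form ≫ dualMap (right a) :=
  TwistedArrow.Hom.comm_g a

theorem right_comm (a : s.EndTwisted) : right a ≫ s.form = s.form ≫ dualMap (left a) := by
  have h := TwistedArrow.dual_comm (Z := s.toTwisted.obj) (W := s.toTwisted.obj)
    (TwistedArrow.Hom.φ a) (TwistedArrow.Hom.ψ a) _ _ (TwistedArrow.Hom.comm_f a)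
  simp only [toTwisted, transpose_transpose] at h
  exact h

end EndTwisted

/-- The involution interchanging the components. -/
def endStar (s : SesqForm C) : s.EndTwisted →+ s.EndTwisted where
  toFun a := mkEnd s a.right a.left a.right_comm a.left_comm
  map_zero' := rfl
  map_add' _ _ := rfl

theorem endStar_isInvolution (s : SesqForm C) : IsInvolution s.endStar where
  mul _ _ := rfl
  invol _ := rfl

/-- Halves are natural, hence adjoint to themselves for every form; this puts ½ into the ring
`EndTwisted`. -/
theorem add_self_half {X Y : C} {h : X ⟶ X} {k : Y ⟶ Y} (hh : h + h = 𝟙 X) (hk : k + k = 𝟙 Y)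
    (f : X ⟶ Y) : h ≫ f = f ≫ k := by
  calc h ≫ f = h ≫ f ≫ (k + k) := by rw [hk, Category.comp_id]
    _ = (h + h) ≫ f ≫ k := by simp
    _ = f ≫ k := by rw [hh, Category.id_comp]

theorem IsHyperbolicIdem.exists_idem_of_summand {r : SesqForm C}
    (hss : IsSemisimpleRing (r.EndTwisted ⧸ Ring.jacobson r.EndTwisted))
    (hlift : LiftsIdempotents r.EndTwisted) {h : r.obj ⟶ r.obj} (hh : h + h = 𝟙 _)
    {e p q : r.obj ⟶ r.obj} (he : IsHyperbolicIdem r e) (hpp : p ≫ p = p)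
    (hp : p ≫ r.form = r.form ≫ dualMap p) (hqq : q ≫ q = q)
    (hq : q ≫ r.form = r.form ≫ dualMap (𝟙 _ - p - q)) (hpq : p ≫ q = 0) (hqp : q ≫ p = 0) :
    ∃ x, x ≫ x = x ∧ p ≫ x = x ∧ x ≫ p = x ∧ x ≫ r.form = r.form ≫ dualMap (p - x) := by
  have hh' : h ≫ r.form = r.form ≫ dualMap h :=
    add_self_half hh (by rw [← dualMap_add, hh, dualMap_id]) _
  have hq' : (𝟙 _ - p - q) ≫ r.form = r.form ≫ dualMap q := by
    rw [dualMap_sub, dualMap_sub, Preadditive.comp_sub, Preadditive.comp_sub, dualMap_id,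
      Category.comp_id, ← hp] at hq
    rw [Preadditive.sub_comp, Preadditive.sub_comp, hq, Category.id_comp]
    abel
  have hee : (𝟙 _ - e) ≫ (𝟙 _ - e) = 𝟙 _ - e := by simp [he.idem]
  have hqq' : (𝟙 _ - p - q) ≫ (𝟙 _ - p - q) = 𝟙 _ - p - q := by simp [hpp, hqq, hpq, hqp]
  have hpq' : p ≫ (𝟙 _ - p - q) = 0 := by simp [hpp, hpq]
  have hqp' : (𝟙 _ - p - q) ≫ p = 0 := by simp [hpp, hqp]
  let P : r.EndTwisted := mkEnd r p p hp hp
  let F : r.EndTwisted := mkEnd r q (𝟙 _ - p - q) hq hq'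
  let E : r.EndTwisted := mkEnd r e (𝟙 _ - e) he.comm he.compl_comm
  let H : r.EndTwisted := mkEnd r h h hh' hh'
  have hE : r.endStar E = 1 - E := by
    refine EndTwisted.ext ?_ ?_
    · rw [EndTwisted.left_sub]; rfl
    · rw [EndTwisted.right_sub]; exact (sub_sub_cancel _ _).symm
  have hF : r.endStar F = 1 - P - F := by
    refine EndTwisted.ext ?_ ?_
    · rw [EndTwisted.left_sub, EndTwisted.left_sub]; rfl
    · rw [EndTwisted.right_sub, EndTwisted.right_sub]; exact (sub_sub_cancel _ _).symm
  -- Multiplication in `End` is composition in reverse order, which is why the relations between p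
  -- and q enter interchanged.
  obtain ⟨g, hg, hPg, hgP, hσg⟩ := (endStar_isInvolution r).exists_idempotent hss hlift
    (t := H) (e := E) (p := P) (f := F) (EndTwisted.ext hh hh) (EndTwisted.ext he.idem hee) hE
    (EndTwisted.ext hpp hpp) rfl (EndTwisted.ext hqq hqq') hF (EndTwisted.ext hqp hpq')
    (EndTwisted.ext hpq hqp')
  refine ⟨g.left, congrArg EndTwisted.left hg, congrArg EndTwisted.left hgP,
    congrArg EndTwisted.left hPg, ?_⟩
  have hy : g.right = p - g.left :=
    (congrArg EndTwisted.left hσg).trans (EndTwisted.left_sub _ _)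
  rw [← hy, g.left_comm]

/-- Cancellation: if `t` and the orthogonal sum of `s` and `t` are hyperbolic, then so is `s`. -/
theorem IsHyperbolicIdem.cancel {s t : SesqForm C}
    (hss : IsSemisimpleRing ((s.orthoSum t).EndTwisted ⧸ Ring.jacobson (s.orthoSum t).EndTwisted))
    (hlift : LiftsIdempotents (s.orthoSum t).EndTwisted)
    (half : ∃ h : (s.orthoSum t).obj ⟶ (s.orthoSum t).obj, h + h = 𝟙 _)
    {e : (s.orthoSum t).obj ⟶ (s.orthoSum t).obj} (he : IsHyperbolicIdem (s.orthoSum t) e)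
    {f : t.obj ⟶ t.obj} (hf : IsHyperbolicIdem t f) : ∃ g, IsHyperbolicIdem s g := by
  obtain ⟨h, hh⟩ := half
  have hff : f ≫ f = f := hf.idem
  have hqp : 𝟙 (s.obj ⊞ t.obj) - biprod.fst ≫ biprod.inl - biprod.snd ≫ f ≫ biprod.inr
      = biprod.snd ≫ (𝟙 _ - f) ≫ biprod.inr := by
    simp only [← biprod.total, Preadditive.sub_comp, Preadditive.comp_sub, Category.id_comp]
    abel
  have hq : (biprod.snd ≫ f ≫ biprod.inr) ≫ diagMat s.form t.form = diagMat s.form t.form ≫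
      dualMap (𝟙 (s.obj ⊞ t.obj) - biprod.fst ≫ biprod.inl - biprod.snd ≫ f ≫ biprod.inr) := by
    have h1 : (biprod.snd ≫ f ≫ biprod.inr : s.obj ⊞ t.obj ⟶ _) ≫ diagMat s.form t.form
        = biprod.snd ≫ (f ≫ t.form) ≫ dualMap biprod.snd := by simp [diagMat]
    have h2 : diagMat s.form t.form ≫
        dualMap (biprod.snd ≫ (𝟙 _ - f) ≫ biprod.inr : s.obj ⊞ t.obj ⟶ s.obj ⊞ t.obj)
        = biprod.snd ≫ (t.form ≫ dualMap (𝟙 _ - f)) ≫ dualMap biprod.snd := by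
      simp only [diagMat, Preadditive.add_comp, Category.assoc, ← dualMap_comp, biprod.inr_fst,
        biprod.inr_snd, comp_zero, dualMap_zero, Category.comp_id, zero_add]
    rw [hqp, h1, h2, hf.comm]
  have hpp : (biprod.fst ≫ biprod.inl : s.obj ⊞ t.obj ⟶ s.obj ⊞ t.obj) ≫
      (biprod.fst ≫ biprod.inl : s.obj ⊞ t.obj ⟶ s.obj ⊞ t.obj) = biprod.fst ≫ biprod.inl := by simp
  have hp : (biprod.fst ≫ biprod.inl : s.obj ⊞ t.obj ⟶ s.obj ⊞ t.obj) ≫ diagMat s.form t.form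
      = diagMat s.form t.form ≫ dualMap (biprod.fst ≫ biprod.inl) := by
    simp [diagMat, ← dualMap_comp]
  have hqq : (biprod.snd ≫ f ≫ biprod.inr : s.obj ⊞ t.obj ⟶ s.obj ⊞ t.obj) ≫
      (biprod.snd ≫ f ≫ biprod.inr : s.obj ⊞ t.obj ⟶ s.obj ⊞ t.obj) = biprod.snd ≫ f ≫ biprod.inr := by
    simp [reassoc_of% hff]
  have hpq : (biprod.fst ≫ biprod.inl : s.obj ⊞ t.obj ⟶ s.obj ⊞ t.obj) ≫
      (biprod.snd ≫ f ≫ biprod.inr : s.obj ⊞ t.obj ⟶ s.obj ⊞ t.obj) = 0 := by simp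
  have hqp' : (biprod.snd ≫ f ≫ biprod.inr : s.obj ⊞ t.obj ⟶ s.obj ⊞ t.obj) ≫
      (biprod.fst ≫ biprod.inl : s.obj ⊞ t.obj ⟶ s.obj ⊞ t.obj) = 0 := by simp
  -- Here p is the projection onto the summand s, and the third idempotent is f acting on the
  -- summand t.
  obtain ⟨x, hxx, hpx, -, hxD⟩ := IsHyperbolicIdem.exists_idem_of_summand hss hlift hh he
    hpp hp hqq hq hpq hqp'
  change s.obj ⊞ t.obj ⟶ s.obj ⊞ t.obj at x
  change x ≫ diagMat s.form t.form = diagMat s.form t.form ≫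
    dualMap (biprod.fst ≫ biprod.inl - x) at hxD
  change x ≫ x = x at hxx
  change (biprod.fst ≫ biprod.inl) ≫ x = x at hpx
  rw [Category.assoc] at hpx
  have hinl : biprod.inl ≫ diagMat s.form t.form = s.form ≫ dualMap biprod.fst := by
    simp [diagMat]
  have hdinl : diagMat s.form t.form ≫ dualMap biprod.inl = biprod.fst ≫ s.form := by
    simp [diagMat, ← dualMap_comp]
  -- The idempotent x lives on the summand s, so its corner there carries all its relations.
  refine ⟨biprod.inl ≫ x ≫ biprod.fst, ?_, ?_⟩
  · simp only [Category.assoc]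
    rw [reassoc_of% hpx, reassoc_of% hxx]
  · have h1 : 𝟙 s.obj - biprod.inl ≫ x ≫ biprod.fst
        = biprod.inl ≫ (biprod.fst ≫ biprod.inl - x) ≫ biprod.fst := by simp
    rw [h1, dualMap_comp, dualMap_comp, Category.assoc, Category.assoc, ← hdinl,
      reassoc_of% hxD, reassoc_of% hinl, Category.assoc]
    rfl

end SesqForm

end Cancellation

end HermCat

namespace HermCat

/-! ### From Witt classes to forms that are stably hyperbolic -/

section WittGroups

variable {C : Type u} [Category.{v} C] [Preadditive C] [HasZeroObject C]
  [HasBinaryBiproducts C] [HermitianStructure C]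

namespace SesqForm

theorem IsHyperbolicIdem.orthoSum {s t : SesqForm C} {e : s.obj ⟶ s.obj} {f : t.obj ⟶ t.obj}
    (he : IsHyperbolicIdem s e) (hf : IsHyperbolicIdem t f) :
    IsHyperbolicIdem (s.orthoSum t) (biprod.map e f) := by
  have hc : (biprod.map e f : s.obj ⊞ t.obj ⟶ s.obj ⊞ t.obj) ≫ diagMat s.form t.form
      = diagMat s.form t.form ≫ dualMap (𝟙 (s.obj ⊞ t.obj) - biprod.map e f) := by
    have h1 : 𝟙 (s.obj ⊞ t.obj) - biprod.map e f = biprod.map (𝟙 _ - e) (𝟙 _ - f) := by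
      ext <;> simp
    have h2 : biprod.map e f ≫ diagMat s.form t.form = biprod.fst ≫ (e ≫ s.form) ≫
        dualMap biprod.fst + biprod.snd ≫ (f ≫ t.form) ≫ dualMap biprod.snd := by
      simp [diagMat]
    rw [h1, h2, he.comm, hf.comm]
    simp only [diagMat, Preadditive.add_comp, Category.assoc, ← dualMap_comp, biprod.map_fst,
      biprod.map_snd]
  have hi : (biprod.map e f : s.obj ⊞ t.obj ⟶ s.obj ⊞ t.obj) ≫ biprod.map e f
      = biprod.map e f := by
    ext <;> simp [he.idem, hf.idem]
  exact ⟨hi, hc⟩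

theorem zeroForm_isHyperbolicIdem : IsHyperbolicIdem (zeroForm C) (𝟙 _) :=
  ⟨Category.comp_id _, (isZero_zero C).eq_of_src _ _⟩

/-- The form `(M, -s)`. -/
def neg (s : SesqForm C) : SesqForm C where
  obj := s.obj
  form := -s.form

theorem IsHermitian.neg {s : SesqForm C} (h : s.IsHermitian) : s.neg.IsHermitian := by
  have h' : s.form = bidual s.obj ≫ dualMap s.form := h
  have : -s.form = bidual s.obj ≫ dualMap (-s.form) := by
    rw [dualMap_neg, Preadditive.comp_neg, ← h']
  exact this

theorem IsUnimodular.neg {s : SesqForm C} (h : s.IsUnimodular) : s.neg.IsUnimodular := by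
  have h1 := h.1
  have h2 := h.2
  have hneg : ∀ {X Y : C} (f : X ⟶ Y) [IsIso f], IsIso (-f) := fun f _ =>
    ⟨-inv f, by simp, by simp⟩
  have h3 : IsIso (-s.form) := hneg _
  have h4 : IsIso (bidual s.obj ≫ dualMap (-s.form)) := by
    rw [dualMap_neg, Preadditive.comp_neg]
    exact hneg _
  exact ⟨h3, h4⟩

/-- Here e sends (x, y) to (½(x + y), ½(x + y)): it projects onto the diagonal along the
antidiagonal, and both are isotropic for s ⊥ -s. -/
theorem diagMat_neg_comm {X : C} (s : X ⟶ dual X) {h : X ⟶ X} (hh : h + h = 𝟙 X)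
    {e : X ⊞ X ⟶ X ⊞ X} (he : e = (biprod.fst + biprod.snd) ≫ h ≫ (biprod.inl + biprod.inr)) :
    e ≫ e = e ∧ e ≫ diagMat s (-s) = diagMat s (-s) ≫ dualMap (𝟙 (X ⊞ X) - e) := by
  have hs : h ≫ s = s ≫ dualMap h :=
    add_self_half hh (by rw [← dualMap_add, hh, dualMap_id]) _
  constructor
  · have h2 : h ≫ (𝟙 _ + 𝟙 _) ≫ h = h := by
      rw [Preadditive.add_comp, Category.id_comp, hh, Category.comp_id]
    have h3 : (biprod.inl + biprod.inr : X ⟶ X ⊞ X) ≫ (biprod.fst + biprod.snd)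
        = 𝟙 _ + 𝟙 _ := by simp
    rw [he, Category.assoc, Category.assoc, reassoc_of% h3, reassoc_of% h2]
  · have h3 : s = s ≫ dualMap h + s ≫ dualMap h := by
      rw [← hs, ← Preadditive.add_comp, hh, Category.id_comp]
    have l1 : biprod.inl ≫ diagMat s (-s) = s ≫ dualMap biprod.fst := by simp [diagMat]
    have l2 : biprod.inr ≫ diagMat s (-s) = -(s ≫ dualMap biprod.snd) := by simp [diagMat]
    have r1 : diagMat s (-s) ≫ dualMap biprod.inl = biprod.fst ≫ s := by
      simp [diagMat, ← dualMap_comp]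
    have r2 : diagMat s (-s) ≫ dualMap biprod.inr = -(biprod.snd ≫ s) := by
      simp [diagMat, ← dualMap_comp]
    have h4 : e ≫ diagMat s (-s) = (biprod.fst + biprod.snd) ≫ (s ≫ dualMap h) ≫
        (dualMap biprod.fst - dualMap biprod.snd) := by
      rw [he, Category.assoc, Category.assoc, Preadditive.add_comp (f := biprod.inl), l1, l2,
        ← sub_eq_add_neg, ← Preadditive.comp_sub, ← hs, Category.assoc]
    have h5 : diagMat s (-s) ≫ dualMap e = (biprod.fst - biprod.snd) ≫ (s ≫ dualMap h) ≫
        (dualMap biprod.fst + dualMap biprod.snd) := by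
      rw [he, dualMap_comp, dualMap_comp, dualMap_add, dualMap_add, Category.assoc,
        ← Category.assoc, Preadditive.comp_add (f := diagMat s (-s)), r1, r2, ← sub_eq_add_neg,
        ← Preadditive.sub_comp, Category.assoc, Category.assoc]
    have h6 : diagMat s (-s) = biprod.fst ≫ (s ≫ dualMap h + s ≫ dualMap h) ≫
        dualMap biprod.fst - biprod.snd ≫ (s ≫ dualMap h + s ≫ dualMap h) ≫
          dualMap biprod.snd := by
      rw [← h3, diagMat, Preadditive.neg_comp, Preadditive.comp_neg, ← sub_eq_add_neg]
    rw [dualMap_sub, dualMap_id, Preadditive.comp_sub, Category.comp_id, h4, h5, h6]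
    simp only [Preadditive.comp_add, Preadditive.add_comp, Preadditive.comp_sub,
      Preadditive.sub_comp]
    abel

/-- If `2` is invertible then the orthogonal sum of a form and its negative is hyperbolic. -/
theorem exists_isHyperbolicIdem_orthoSum_neg (s : SesqForm C) {h : s.obj ⟶ s.obj}
    (hh : h + h = 𝟙 _) : ∃ e, IsHyperbolicIdem (s.orthoSum s.neg) e :=
  ⟨_, (diagMat_neg_comm s.form hh rfl).1, (diagMat_neg_comm s.form hh rfl).2⟩

end SesqForm

theorem grothendieck_of_eq_of_iff {M : Type*} [AddCommMonoid M] {x y : M} :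
    Algebra.GrothendieckAddGroup.of x = Algebra.GrothendieckAddGroup.of y ↔
      ∃ c, c + x = c + y := by
  refine (AddLocalization.mk_eq_mk_iff (S := ⊤)).trans ?_
  rw [AddLocalization.r_iff_exists]
  simp

/-- Orthogonal sums of hyperbolic forms are hyperbolic, so the subgroup they generate consists of
differences of two such classes. -/
theorem exists_of_mem_sesqHyperbolic [IsIdempotentComplete C] {x : SesqGrothendieck C}
    (hx : x ∈ sesqHyperbolic C) : ∃ s t : SesqForm C, s.IsHyperbolic ∧ t.IsHyperbolic ∧
      x + Algebra.GrothendieckAddGroup.of s.cls = Algebra.GrothendieckAddGroup.of t.cls := by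
  have hadd : ∀ {s t : SesqForm C}, s.IsHyperbolic → t.IsHyperbolic →
      (s.orthoSum t).IsHyperbolic := by
    intro s t hs ht
    obtain ⟨e, he⟩ := hs.exists_idem
    obtain ⟨f, hf⟩ := ht.exists_idem
    exact (he.orthoSum hf).isHyperbolic
  have h0 : (SesqForm.zeroForm C).IsHyperbolic :=
    SesqForm.zeroForm_isHyperbolicIdem.isHyperbolic
  have hz : Algebra.GrothendieckAddGroup.of (SesqForm.zeroForm C).cls = 0 :=
    map_zero (Algebra.GrothendieckAddGroup.of (M := SesqClass C))
  induction hx using AddSubgroup.closure_induction with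
  | mem x h =>
    obtain ⟨s, hs, rfl⟩ := h
    exact ⟨_, s, h0, hs, by rw [hz, add_zero]⟩
  | zero => exact ⟨_, _, h0, h0, zero_add _⟩
  | add x y _ _ hx hy =>
    obtain ⟨s, t, hs, ht, h⟩ := hx
    obtain ⟨s', t', hs', ht', h'⟩ := hy
    refine ⟨_, _, hadd hs hs', hadd ht ht', ?_⟩
    rw [← SesqForm.cls_add, ← SesqForm.cls_add, map_add, map_add, ← h, ← h']
    abel
  | neg x _ hx =>
    obtain ⟨s, t, hs, ht, h⟩ := hx
    exact ⟨t, s, ht, hs, by rw [← h]; abel⟩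

theorem SesqForm.IsHyperbolic.wittS_eq_zero {s : SesqForm C} (h : s.IsHyperbolic) :
    s.wittS = 0 :=
  (QuotientAddGroup.eq_zero_iff _).mpr (AddSubgroup.subset_closure ⟨s, h, rfl⟩)

/-- A form with trivial Witt class becomes hyperbolic after adding a hyperbolic form. -/
theorem SesqForm.exists_isHyperbolic_orthoSum [IsIdempotentComplete C]
    (half : ∀ M : C, ∃ h : M ⟶ M, h + h = 𝟙 M) {s : SesqForm C} (hs : s.wittS = 0) :
    ∃ t : SesqForm C, t.IsHyperbolic ∧ (s.orthoSum t).IsHyperbolic := by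
  obtain ⟨t₁, t₂, h1, h2, h⟩ :=
    exists_of_mem_sesqHyperbolic ((QuotientAddGroup.eq_zero_iff _).mp hs)
  rw [← map_add, grothendieck_of_eq_of_iff] at h
  obtain ⟨⟨c⟩, h⟩ := h
  change c.cls + (s.cls + t₁.cls) = c.cls + t₂.cls at h
  obtain ⟨e₁, he₁⟩ := h1.exists_idem
  obtain ⟨e₂, he₂⟩ := h2.exists_idem
  obtain ⟨k, hk⟩ := half c.obj
  obtain ⟨d, hc⟩ := c.exists_isHyperbolicIdem_orthoSum_neg hk
  -- The Grothendieck group gives an equality only after adding some c. Adding -c as well makes the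
  -- auxiliary summand c ⊥ -c hyperbolic, and it is absorbed on both sides.
  have h3 : s.cls + (t₁.cls + (c.cls + c.neg.cls)) = t₂.cls + (c.cls + c.neg.cls) :=
    calc _ = c.cls + (s.cls + t₁.cls) + c.neg.cls := by abel
      _ = _ := by rw [h]; abel
  exact ⟨t₁.orthoSum (c.orthoSum c.neg), (he₁.orthoSum hc).isHyperbolic,
    IsHyperbolic.of_isometric (cls_eq_iff.mp h3) (he₂.orthoSum hc).isHyperbolic⟩

theorem SesqForm.witt_orthoSum {s t : SesqForm C} (hs : s.IsHermitian) (hu : s.IsUnimodular)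
    (ht : t.IsHermitian) (hv : t.IsUnimodular) :
    (s.orthoSum t).witt (hs.orthoSum ht) (hu.orthoSum hv) = s.witt hs hu + t.witt ht hv :=
  congrArg (QuotientAddGroup.mk (s := hermHyperbolic C))
    (map_add Algebra.GrothendieckAddGroup.of (⟨s.cls, s, hs, hu, rfl⟩ : hermClasses C)
      (⟨t.cls, t, ht, hv, rfl⟩ : hermClasses C))

theorem SesqForm.IsHermHyperbolic.witt_eq_zero {s : SesqForm C} (h : s.IsHermHyperbolic)
    (hs : s.IsHermitian) (hu : s.IsUnimodular) : s.witt hs hu = 0 :=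
  (QuotientAddGroup.eq_zero_iff _).mpr (AddSubgroup.subset_closure ⟨s, hs, hu, h, rfl⟩)

/-- Every element of the Witt group is represented by a unimodular hermitian form. -/
theorem exists_witt_eq [IsIdempotentComplete C] (half : ∀ M : C, ∃ h : M ⟶ M, h + h = 𝟙 M)
    (x : Witt C) : ∃ (s : SesqForm C) (hs : s.IsHermitian) (hu : s.IsUnimodular),
      x = s.witt hs hu := by
  obtain ⟨y, rfl⟩ := QuotientAddGroup.mk_surjective x
  induction y using AddLocalization.induction_on with
  | H y =>
  obtain ⟨⟨_, s, hs, hu, rfl⟩, ⟨⟨_, t, ht, hv, rfl⟩, -⟩⟩ := y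
  refine ⟨s.orthoSum t.neg, hs.orthoSum ht.neg, hu.orthoSum hv.neg, ?_⟩
  obtain ⟨k, hk⟩ := half t.obj
  obtain ⟨e, he⟩ := t.exists_isHyperbolicIdem_orthoSum_neg hk
  -- As t ⊥ -t is hyperbolic, the class of -t is the negative of the class of t, so a difference of
  -- classes is the class of one form.
  have h0 : t.witt ht hv + t.neg.witt ht.neg hv.neg = 0 := by
    rw [← SesqForm.witt_orthoSum]
    exact (he.isHermHyperbolic (ht.orthoSum ht.neg) (hv.orthoSum hv.neg)).witt_eq_zero _ _
  rw [SesqForm.witt_orthoSum hs hu ht.neg hv.neg, ← neg_eq_of_add_eq_zero_right h0, ← sub_eq_add_neg]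
  refine congrArg (QuotientAddGroup.mk (s := hermHyperbolic C)) (a₂ :=
    Algebra.GrothendieckAddGroup.of (⟨s.cls, s, hs, hu, rfl⟩ : hermClasses C) -
      Algebra.GrothendieckAddGroup.of (⟨t.cls, t, ht, hv, rfl⟩ : hermClasses C)) ?_
  refine Eq.trans ?_ (Algebra.GrothendieckAddGroup.mk_sub_mk _ _ _ _).symm
  rw [AddLocalization.mk_eq_mk_iff, AddLocalization.r_iff_exists]
  exact ⟨0, by simp⟩

/-- Forms with trivial Witt class are hyperbolic and `W(C) ⟶ W_S(C)` is injective, provided that `2`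
is invertible and the endomorphism rings of twisted double arrows are well-behaved. -/
theorem wittS_eq_zero_iff_and_injective [IsIdempotentComplete C]
    (half : ∀ M : C, ∃ h : M ⟶ M, h + h = 𝟙 M)
    (hend : ∀ r : SesqForm C,
      IsSemisimpleRing (r.EndTwisted ⧸ Ring.jacobson r.EndTwisted) ∧
        LiftsIdempotents r.EndTwisted) :
    (∀ s : SesqForm C, s.wittS = 0 ↔ s.IsHyperbolic) ∧ Function.Injective (wittToWittS C) := by
  have main : ∀ s : SesqForm C, s.wittS = 0 → ∃ e, SesqForm.IsHyperbolicIdem s e := by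
    intro s hs
    obtain ⟨t, ht, hst⟩ := SesqForm.exists_isHyperbolic_orthoSum half hs
    obtain ⟨e, he⟩ := hst.exists_idem
    obtain ⟨f, hf⟩ := ht.exists_idem
    exact he.cancel (hend _).1 (hend _).2 (half _) hf
  refine ⟨fun s => ⟨fun hs => ?_, fun h => h.wittS_eq_zero⟩, ?_⟩
  · obtain ⟨e, he⟩ := main s hs
    exact he.isHyperbolic
  · refine (injective_iff_map_eq_zero _).mpr fun x hx => ?_
    obtain ⟨s, hs, hu, rfl⟩ := exists_witt_eq half x
    rw [wittToWittS_witt] at hx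
    obtain ⟨e, he⟩ := main s hx
    exact (he.isHermHyperbolic hs hu).witt_eq_zero hs hu

end WittGroups

end HermCat

theorem mainTheorem9 (C : Type u) [Category.{v} C] [Preadditive C] [HasZeroObject C]
    [HasBinaryBiproducts C] [HermCat.HermitianStructure C] [IsIdempotentComplete C]
    (h : (∃ (K : Type w) (_ : CommRing K) (_ : Linear K C),
          IsNoetherianRing K ∧ HermCat.IsCompleteSemilocal K ∧ IsUnit (2 : K) ∧
          HermCat.IsLinearHermitian K C ∧ ∀ M N : C, Module.Finite K (M ⟶ N)) ∨
        (∀ M : C, IsSemiprimaryRing (End M) ∧ IsUnit (2 : End M))) :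
    (∀ s : HermCat.SesqForm C, s.wittS = 0 ↔ s.IsHyperbolic) ∧
      Function.Injective (HermCat.wittToWittS C) := by
  rcases h with ⟨K, _, _, _, hKs, h2, hK, hfin⟩ | h
  · refine HermCat.wittS_eq_zero_iff_and_injective (fun M => ?_) fun r =>
      HermCat.TwistedArrow.isSemisimpleRing_and_liftsIdempotents hK hKs hfin _
    obtain ⟨a, ha⟩ := h2.exists_right_inv
    exact ⟨a • 𝟙 M, by rw [← add_smul, ← two_mul, ha, one_smul]⟩
  · refine HermCat.wittS_eq_zero_iff_and_injective (fun M => ?_) fun r => ?_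
    · obtain ⟨a, ha⟩ := (h M).2.exists_right_inv
      exact ⟨a, (two_mul a).symm.trans ha⟩
    · have h1 : IsSemiprimaryRing (End r.toTwisted.obj.src) := (h r.obj).1
      have h2 : IsSemiprimaryRing (End r.toTwisted.obj.tgt) := (h r.obj).1
      exact ⟨HermCat.TwistedArrow.isSemisimpleRing_quotient_jacobson _,
        HermCat.liftsIdempotents_of_isNilpotent fun x hx =>
          HermCat.TwistedArrow.isNilpotent_of_mem_jacobson hx⟩
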